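/- Consider $\min_{x\in\mathbb R^n} f(x)$ subject to $c(x)=0$, with $f:\mathbb R^n\to\mathbb R$, $c:\mathbb R^n\to\mathbb R^m$, $A(x)=\nabla c(x)^\top$, Lagrangian $\mathcal L(x,\lambda)=f(x)+\lambda^\top c(x)$, merit function $\varphi(x,\mu)=f(x)+\mu\|c(x)\|_1$. Write $f_k=f(x_k)$, $g_k=\nabla f(x_k)$, $c_k=c(x_k)$, $A_k=A(x_k)$, $H_k=\nabla^2 f(x_k)+\sum_i\lambda_k^i\nabla^2c_i(x_k)$, $P_k$ for the orthogonal projection onto $\mathcal N(A_k)$, $Z_k$ for a matrix whose columns form an orthonormal basis of $\mathcal N(A_k)$; $\|\cdot\|$ is the Euclidean (operator) norm, $\lambda_{\min}$ the smallest eigenvalue (the bound $\lambda_{\min}(Z_k^\top H_kZ_k)\ge-\epsilon_H$ is regarded as true if $\mathcal N(A_k)=\{0\}$). **Algorithm (SCP).** Parameters: $\sigma_0\ge\sigma_{\min}>0$, $\mu_{-1}>0$, $0<\eta_1<\eta_2<1$, $\nu>1$, $\tau\in(0,1)$, $\theta\in(0,1]$, $\zeta\in(0,\theta)$, $\gamma_2>\gamma_1>1$,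 $\gamma_3\in(0,1]$, $\delta\in(0,1/6)$, $r_v\in[0,1-\tau)$, $r_\lambda,r_w\ge0$; tolerances $\epsilon_g,\epsilon_c,\epsilon_H$; a starting point $x_0$. For $k=0,1,2,\dots$: 1. *Normal step.* If $c_k=0$, put $v_k=v_k^c=0$, $\beta_k=1$. Otherwise choose $v_k^c\in\mathcal R(A_k^\top)$ with $\|A_kv_k^c+c_k\|_1\le r_v\min\{\|c_k\|_1,\|v_k^c\|^3\}$, $\beta_k\in\big[\min\{1,\tfrac{\theta}{\|v_k^c\|\sqrt{\sigma_k}}\},\min\{1,\tfrac{1}{\|v_k^c\|\sqrt{\sigma_k}}\}\big]$, and put $v_k=\beta_kv_k^c$. 2. *Multipliers.* Choose $\lambda_k$ with $\|A_k(g_k+A_k^\top\lambda_k)\|\le r_\lambda\|v_k\|$. 3. *Stopping test.* Stop if $\|\nabla_x\mathcal L(x_k,\lambda_k)\|\le\epsilon_g$, $\|c_k\|_1\le\epsilon_c$ and $\lambda_{\min}(Z_k^\top H_kZ_k)\ge-\epsilon_H$. 4. *Tangential step.* With $\tilde g_k=P_k^\top(g_k+H_kv_k)$, $\tilde H_k=P_k^\top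 H_kP_k$, $m_k^U(u)=f_k+\tilde g_k^\top u+\tfrac12u^\top\tilde H_ku+\tfrac{\sigma_k}{3}\|P_ku\|^3$, an oracle returns $u_k\in\mathcal R(P_k)$ such that $m_k^U(u_k)\le m_k^U(-\alpha_k^*\tilde g_k)$ where $\alpha_k^*$ minimizes $m_k^U(-\alpha\tilde g_k)$ over $\alpha\ge0$; $\|\nabla m_k^U(u_k)\|\le\delta\sigma_k\|u_k\|^2$; $\lambda_{\min}(P_k^\top H_kP_k)\ge-\sigma_k\|u_k\|$. Put $d_k=v_k+u_k$. 5. *Merit parameter.* Let $\mu_k^c=0$ if $c_k=0$ and otherwise $\mu_k^c=\dfrac{g_k^\top v_k+\frac12v_k^\top H_kv_k+\frac{\sigma_k}{3}(\|d_k\|^3-\|u_k\|^3)}{(1-r_v-\tau)\beta_k\|c_k\|_1}$; put $\mu_k=\nu\mu_k^c$ if $\mu_{k-1}<\mu_k^c$ and $\mu_k=\mu_{k-1}$ otherwise. 6. *Step acceptance.* Let $q_k(d)=f_k+g_k^\top d+\frac12d^\top H_kd+\frac{\sigma_k}{3}\|d\|^3+\mu_k\|c_k+A_kd\|_1$, $\Delta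 q_k=q_k(0)-q_k(d_k)$, $\rho_k=\dfrac{\varphi(x_k,\mu_k)-\varphi(x_k+d_k,\mu_k)}{\Delta q_k}$. If $\rho_k\ge\eta_1$, put $x_{k+1}=x_k+d_k$. If $\rho_k<\eta_1$ and $\|v_k^c\|\le\zeta/\sqrt{\sigma_k}$, compute $w_k\in\mathcal R(A_k^\top)$ with $\|A_kw_k+c(x_k+d_k)\|\le r_w\|d_k\|^3$ and $\rho_k^{corr}=\dfrac{\varphi(x_k,\mu_k)-\varphi(x_k+d_k+w_k,\mu_k)}{\Delta q_k}$, and if $\rho_k^{corr}\ge\eta_1$ put $x_{k+1}=x_k+d_k+w_k$. In these two cases of acceptance the iteration is *successful*; otherwise it is unsuccessful and $x_{k+1}=x_k$. 7. *Regularization parameter.* If the iteration is successful and the ratio ($\rho_k$ or $\rho_k^{corr}$) of the accepted step exceeds $\eta_2$, choose $\sigma_{k+1}\in[\max\{\sigma_{\min},\gamma_3\sigma_k\},\sigma_k]$; if it is successful and this ratio is at most $\eta_2$, put $\sigma_{k+1}=\sigma_k$; if it is unsuccessful, choose $\sigma_{k+1}\in[\gamma_1\sigma_k,\gamma_2\sigma_k]$.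 **Assumptions.** $\mathcal X\subseteq\mathbb R^n$ is open and convex and contains all iterates $x_k$ and all trial points $x_k+d_k$ and (when a correction is computed) $x_k+d_k+w_k$ of the run. On $\mathcal X$, $f$ and $c$ are $C^2$; $f,\nabla f,\nabla^2f$ and, for every $i$, $c_i,\nabla c_i,\nabla^2c_i$ are bounded and Lipschitz continuous with given constants, $|c_i|\le\kappa_{c_i}$, $\kappa_c:=\sum_i\kappa_{c_i}$; for some given $\gamma_A>0$, the smallest of the $m$ singular values of $A(x)$ is at least $\gamma_A$ for all $x\in\mathcal X$ (so $A(x)$ has full row rank). Moreover $f(x_k)\ge f_{low}$ for all iterates. **Theorem.** There are constants $\alpha_1,\alpha_2,\alpha_3,\alpha_4>0$, $\mu_{\max}>0$, $\sigma^*>0$, depending only on $m$, on the parameters of the algorithm and on the bounds, Lipschitz constants and $\gamma_A$ above, such that with $\sigma_{\max}:=\max\{\sigma_0,\gamma_2\sigma^*\}$ the following holds for all $\epsilon_g,\epsilon_c,\epsilon_H\in(0,1)$ and every run that satisfies the assumptions. Throughout the run $\mu_k\le\mu_{\max}$ and $\sigma_k\le\sigma_{\max}$. The algorithm reaches an iterate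 with $$\|\nabla_x\mathcal L(x_k,\lambda_k)\|\le\epsilon_g,\qquad\|c_k\|_1\le\epsilon_c,\qquad\lambda_{\min}(Z_k^\top H_kZ_k)\ge-\epsilon_H$$ after at most $\big\lceil\kappa_s\max\{\epsilon_g^{-3/2},\epsilon_c^{-1},\epsilon_H^{-3}\}\big\rceil+1$ successful iterations, where $$\kappa_s:=\frac{f(x_0)-f_{low}+2\kappa_c\mu_{\max}}{\eta_1\min\{\alpha_1,\alpha_2,\alpha_3,\alpha_4\}},$$ and after at most $\big\lceil\tilde\kappa_s\max\{\epsilon_g^{-3/2},\epsilon_c^{-1},\epsilon_H^{-3}\}\big\rceil+1$, and also at most $\big\lceil\tfrac{\tilde\kappa_s}{\log\gamma_1}\max\{\epsilon_g^{-3/2},\epsilon_c^{-1},\epsilon_H^{-3}\}\big\rceil+1$, iterations in total, where $$\tilde\kappa_s:=(\log\gamma_1-\log\gamma_3)\kappa_s+\frac{\sigma_{\max}}{\sigma_0}.$$ -/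

import Mathlib

namespace SCP

/-- `ℝⁿ` with its Euclidean norm. -/
abbrev Vec (n : ℕ) := EuclideanSpace ℝ (Fin n)

/-- The `ℓ¹` norm on `ℝᵐ`. -/
noncomputable def l1 {m : ℕ} (y : Vec m) : ℝ := ∑ i, |y i|

/-- The Hessian of `h` at `x`, as a linear operator. -/
noncomputable def hess {n : ℕ} (h : Vec n → ℝ) (x : Vec n) : Vec n →L[ℝ] Vec n :=
  fderiv ℝ (gradient h) x

/-- The smallest eigenvalue of an operator on a finite-dimensional real space. On the zero space
there is no eigenvalue and the value is `0`, so that every bound `-ε ≤ minEig T` with `0 ≤ ε`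
holds there, as it should. -/
noncomputable def minEig {V : Type*} [NormedAddCommGroup V] [NormedSpace ℝ V]
    (T : V →L[ℝ] V) : ℝ :=
  sInf {t : ℝ | Module.End.HasEigenvalue (T : V →ₗ[ℝ] V) t}

/-- The data of the problem: minimize `f x` subject to `c x = 0`. -/
structure Problem (n m : ℕ) where
  f : Vec n → ℝ
  c : Vec n → Vec m

namespace Problem

variable {n m : ℕ} (Q : Problem n m)

/-- The `i`-th constraint function. -/
def comp (i : Fin m) : Vec n → ℝ := fun x => Q.c x i

/-- The Jacobian `A(x)` of the constraints. -/
noncomputable def A (x : Vec n) : Vec n →L[ℝ] Vec m := fderiv ℝ Q.c x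

/-- The transpose `A(x)ᵀ` of the Jacobian. -/
noncomputable def AT (x : Vec n) : Vec m →L[ℝ] Vec n := ContinuousLinearMap.adjoint (Q.A x)

/-- The null space of the Jacobian. -/
noncomputable def null (x : Vec n) : Submodule ℝ (Vec n) := (Q.A x).ker

/-- The orthogonal projection matrix `P(x)` onto the null space of the Jacobian. -/
noncomputable def P (x : Vec n) : Vec n →L[ℝ] Vec n := (Q.null x).starProjection

/-- The Lagrangian `f(x) + lamᵀ c(x)`. -/
noncomputable def lagrangian (x : Vec n) (lam : Vec m) : ℝ := Q.f x + inner ℝ lam (Q.c x)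

/-- The gradient of the Lagrangian with respect to `x`. -/
noncomputable def gradLag (x : Vec n) (lam : Vec m) : Vec n :=
  gradient (fun y => Q.lagrangian y lam) x

/-- The Hessian of the Lagrangian, `∇²f(x) + ∑ᵢ lamᵢ ∇²cᵢ(x)`. -/
noncomputable def H (x : Vec n) (lam : Vec m) : Vec n →L[ℝ] Vec n :=
  hess Q.f x + ∑ i, lam i • hess (Q.comp i) x

/-- The reduced Hessian `Zᵀ H Z`, where the columns of `Z` are an orthonormal basis of the null
space of the Jacobian. It is written as an operator on that null space; its matrix in the
orthonormal basis `Z` is `Zᵀ H Z`, so the eigenvalues are those of `Zᵀ H Z`. -/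
noncomputable def reducedHess (x : Vec n) (lam : Vec m) : Q.null x →L[ℝ] Q.null x :=
  (Q.null x).orthogonalProjectionOnto ∘L Q.H x lam ∘L (Q.null x).subtypeL

/-- The merit function `φ(x, μ) = f(x) + μ ‖c(x)‖₁`. -/
noncomputable def merit (x : Vec n) (mu : ℝ) : ℝ := Q.f x + mu * l1 (Q.c x)

end Problem

/-- The input parameters of the algorithm, except for the starting point. -/
structure Params where
  sigma0 : ℝ
  sigmaMin : ℝ
  /-- the initial merit parameter `μ₋₁` -/
  muInit : ℝ
  eta1 : ℝ
  eta2 : ℝ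
  nu : ℝ
  tau : ℝ
  theta : ℝ
  zeta : ℝ
  gamma1 : ℝ
  gamma2 : ℝ
  gamma3 : ℝ
  delta : ℝ
  rv : ℝ
  rlam : ℝ
  rw : ℝ
  sigmaMin_pos : 0 < sigmaMin
  sigmaMin_le : sigmaMin ≤ sigma0
  muInit_pos : 0 < muInit
  eta1_pos : 0 < eta1
  eta1_lt : eta1 < eta2
  eta2_lt : eta2 < 1
  nu_gt : 1 < nu
  tau_pos : 0 < tau
  tau_lt : tau < 1
  theta_pos : 0 < theta
  theta_le : theta ≤ 1
  zeta_pos : 0 < zeta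
  zeta_lt : zeta < theta
  gamma1_gt : 1 < gamma1
  gamma2_gt : gamma1 < gamma2
  gamma3_pos : 0 < gamma3
  gamma3_le : gamma3 ≤ 1
  delta_pos : 0 < delta
  delta_lt : delta < 1 / 6
  rv_nonneg : 0 ≤ rv
  rv_lt : rv < 1 - tau
  rlam_nonneg : 0 ≤ rlam
  rw_nonneg : 0 ≤ rw

/-- The sequences of quantities that the algorithm computes: iterates, regularization parameters,
merit parameters, the vectors `vᶜ`, the feasibility parameters `β`, the normal steps `v`, the
multipliers, the tangential steps `u` and the correction steps `w`. The rules that they obey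
are in `IsRun`. -/
structure Trace (n m : ℕ) where
  x : ℕ → Vec n
  sigma : ℕ → ℝ
  mu : ℕ → ℝ
  vc : ℕ → Vec n
  beta : ℕ → ℝ
  v : ℕ → Vec n
  lam : ℕ → Vec m
  u : ℕ → Vec n
  w : ℕ → Vec n

section Iteration

variable {n m : ℕ} (p : Params) (Q : Problem n m) (T : Trace n m)

namespace Trace

/-- The trial step `d = v + u`. -/
noncomputable def d (k : ℕ) : Vec n := T.v k + T.u k

/-- The gradient of the objective at iterate `k`. -/
noncomputable def g (k : ℕ) : Vec n := gradient Q.f (T.x k)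

/-- The Hessian of the Lagrangian at iteration `k`. -/
noncomputable def H (k : ℕ) : Vec n →L[ℝ] Vec n := Q.H (T.x k) (T.lam k)

/-- `g̃ = Pᵀ (g + H v)`; note that `Pᵀ = P`. -/
noncomputable def gt (k : ℕ) : Vec n := Q.P (T.x k) (T.g Q k + T.H Q k (T.v k))

/-- `H̃ = Pᵀ H P`; note that `Pᵀ = P`. -/
noncomputable def Ht (k : ℕ) : Vec n →L[ℝ] Vec n :=
  Q.P (T.x k) ∘L T.H Q k ∘L Q.P (T.x k)

/-- The cubic model of the tangential subproblem. -/
noncomputable def mU (k : ℕ) (u : Vec n) : ℝ :=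
  Q.f (T.x k) + inner ℝ (T.gt Q k) u + 1 / 2 * inner ℝ u (T.Ht Q k u)
    + T.sigma k / 3 * ‖Q.P (T.x k) u‖ ^ 3

/-- The predicted reduction of the tangential model. -/
noncomputable def redU (k : ℕ) (u : Vec n) : ℝ := T.mU Q k 0 - T.mU Q k u

/-- The cubic model of the merit function. -/
noncomputable def q (k : ℕ) (d : Vec n) : ℝ :=
  Q.f (T.x k) + inner ℝ (T.g Q k) d + 1 / 2 * inner ℝ d (T.H Q k d)
    + T.sigma k / 3 * ‖d‖ ^ 3 + T.mu k * l1 (Q.c (T.x k) + Q.A (T.x k) d)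

/-- The predicted reduction of the merit function. -/
noncomputable def redq (k : ℕ) : ℝ := T.q Q k 0 - T.q Q k (T.d k)

/-- The ratio `ρ` of actual to predicted reduction. -/
noncomputable def rho (k : ℕ) : ℝ :=
  (Q.merit (T.x k) (T.mu k) - Q.merit (T.x k + T.d k) (T.mu k)) / T.redq Q k

/-- The ratio `ρᶜᵒʳʳ` for the corrected step. -/
noncomputable def rhoCorr (k : ℕ) : ℝ :=
  (Q.merit (T.x k) (T.mu k) - Q.merit (T.x k + T.d k + T.w k) (T.mu k)) / T.redq Q k

/-- The previous merit parameter `μ_{k-1}`. -/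
def muPrev : ℕ → ℝ
  | 0 => p.muInit
  | k + 1 => T.mu k

open Classical in
/-- The trial value `μᶜ` of the merit parameter. -/
noncomputable def muC (k : ℕ) : ℝ :=
  if l1 (Q.c (T.x k)) = 0 then 0
  else (inner ℝ (T.g Q k) (T.v k) + 1 / 2 * inner ℝ (T.v k) (T.H Q k (T.v k))
      + T.sigma k / 3 * (‖T.d k‖ ^ 3 - ‖T.u k‖ ^ 3))
    / ((1 - p.rv - p.tau) * T.beta k * l1 (Q.c (T.x k)))

/-- A second-order correction step is computed at iteration `k`: the trial step fails the ratio
test and the iterate is almost feasible. -/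
def Corrects (k : ℕ) : Prop :=
  T.rho Q k < p.eta1 ∧ ‖T.vc k‖ ≤ p.zeta / √(T.sigma k)

/-- Iteration `k` is successful or very successful. -/
def Successful (k : ℕ) : Prop :=
  p.eta1 ≤ T.rho Q k ∨ (T.Corrects p Q k ∧ p.eta1 ≤ T.rhoCorr Q k)

open Classical in
/-- The ratio of the step that a successful iteration accepts. -/
noncomputable def ratio (k : ℕ) : ℝ :=
  if p.eta1 ≤ T.rho Q k then T.rho Q k else T.rhoCorr Q k

/-- Iterate `k`, with its multipliers, is approximately second-order stationary. -/
def Stationary (epsg epsc epsH : ℝ) (k : ℕ) : Prop :=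
  ‖Q.gradLag (T.x k) (T.lam k)‖ ≤ epsg ∧ l1 (Q.c (T.x k)) ≤ epsc ∧
    -epsH ≤ minEig (Q.reducedHess (T.x k) (T.lam k))

/-- The normal step: `v = β vᶜ`, with `vᶜ` in the range of `Aᵀ` an approximate solution of
`A vᶜ + c = 0`; if `c = 0` then `v = vᶜ = 0` and `β = 1`. -/
structure NormalStep (k : ℕ) : Prop where
  v_eq : T.v k = T.beta k • T.vc k
  vc_mem : T.vc k ∈ (Q.AT (T.x k)).range
  residual : l1 (Q.A (T.x k) (T.vc k) + Q.c (T.x k))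
    ≤ p.rv * min (l1 (Q.c (T.x k))) (‖T.vc k‖ ^ 3)
  feasible : Q.c (T.x k) = 0 → T.vc k = 0 ∧ T.beta k = 1
  beta_ge : Q.c (T.x k) ≠ 0 → min 1 (p.theta / (‖T.vc k‖ * √(T.sigma k))) ≤ T.beta k
  beta_le : Q.c (T.x k) ≠ 0 → T.beta k ≤ min 1 (1 / (‖T.vc k‖ * √(T.sigma k)))

/-- The multipliers are approximate least-squares multipliers. -/
def Multipliers (k : ℕ) : Prop :=
  ‖Q.A (T.x k) (T.g Q k + Q.AT (T.x k) (T.lam k))‖ ≤ p.rlam * ‖T.v k‖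

/-- The conditions on the tangential step that the oracle returns. -/
structure Oracle (k : ℕ) : Prop where
  mem_range : T.u k ∈ (Q.P (T.x k)).range
  /-- at least the model reduction of the Cauchy step -/
  cauchy : ∃ a : ℝ, 0 ≤ a ∧ IsMinOn (fun b : ℝ => T.mU Q k (-(b • T.gt Q k))) (Set.Ici 0) a ∧
    T.redU Q k (-(a • T.gt Q k)) ≤ T.redU Q k (T.u k)
  grad : ‖gradient (T.mU Q k) (T.u k)‖ ≤ p.delta * T.sigma k * ‖T.u k‖ ^ 2
  curvature : -(T.sigma k * ‖T.u k‖) ≤ minEig (T.Ht Q k)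

/-- The update of the merit parameter. -/
structure MeritUpdate (k : ℕ) : Prop where
  increase : T.muPrev p k < T.muC p Q k → T.mu k = p.nu * T.muC p Q k
  keep : T.muC p Q k ≤ T.muPrev p k → T.mu k = T.muPrev p k

/-- The correction step lies in the range of `Aᵀ` and approximately solves
`A w + c(x + d) = 0`. -/
structure CorrectionStep (k : ℕ) : Prop where
  mem_range : T.w k ∈ (Q.AT (T.x k)).range
  residual : ‖Q.A (T.x k) (T.w k) + Q.c (T.x k + T.d k)‖ ≤ p.rw * ‖T.d k‖ ^ 3

/-- The update of the iterate. -/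
structure IterateUpdate (k : ℕ) : Prop where
  plain : p.eta1 ≤ T.rho Q k → T.x (k + 1) = T.x k + T.d k
  corrected : T.Corrects p Q k → p.eta1 ≤ T.rhoCorr Q k →
    T.x (k + 1) = T.x k + T.d k + T.w k
  rejected : ¬ T.Successful p Q k → T.x (k + 1) = T.x k

/-- The update of the regularization parameter. -/
structure SigmaUpdate (k : ℕ) : Prop where
  verySuccessful : T.Successful p Q k → p.eta2 < T.ratio p Q k →
    T.sigma (k + 1) ∈ Set.Icc (max p.sigmaMin (p.gamma3 * T.sigma k)) (T.sigma k)
  successful : T.Successful p Q k → T.ratio p Q k ≤ p.eta2 → T.sigma (k + 1) = T.sigma k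
  unsuccessful : ¬ T.Successful p Q k →
    T.sigma (k + 1) ∈ Set.Icc (p.gamma1 * T.sigma k) (p.gamma2 * T.sigma k)

/-- With these tolerances the algorithm computes iterate `k`, its normal step and its
multipliers: no earlier iterate has stopped it. Iteration `k` is carried out in full if and only
if `Reached (k + 1)`. -/
def Reached (epsg epsc epsH : ℝ) (k : ℕ) : Prop :=
  ∀ j < k, ¬ T.Stationary Q epsg epsc epsH j

/-- `T` is a run of the algorithm with the given tolerances. Nothing is required of the entries
of `T` that belong to iterations after the algorithm has stopped. -/
structure IsRun (epsg epsc epsH : ℝ) : Prop where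
  init : T.sigma 0 = p.sigma0
  normal : ∀ k, T.Reached Q epsg epsc epsH k → T.NormalStep p Q k
  multipliers : ∀ k, T.Reached Q epsg epsc epsH k → T.Multipliers p Q k
  oracle : ∀ k, T.Reached Q epsg epsc epsH (k + 1) → T.Oracle p Q k
  merit : ∀ k, T.Reached Q epsg epsc epsH (k + 1) → T.MeritUpdate p Q k
  correction : ∀ k, T.Reached Q epsg epsc epsH (k + 1) → T.Corrects p Q k →
    T.CorrectionStep p Q k
  iterate : ∀ k, T.Reached Q epsg epsc epsH (k + 1) → T.IterateUpdate p Q k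
  sigma : ∀ k, T.Reached Q epsg epsc epsH (k + 1) → T.SigmaUpdate p Q k

/-- All iterates and all trial points of the run lie in `X`. -/
structure StaysIn (X : Set (Vec n)) (epsg epsc epsH : ℝ) : Prop where
  iterate : ∀ k, T.Reached Q epsg epsc epsH k → T.x k ∈ X
  trial : ∀ k, T.Reached Q epsg epsc epsH (k + 1) → T.x k + T.d k ∈ X
  corrected : ∀ k, T.Reached Q epsg epsc epsH (k + 1) → T.Corrects p Q k →
    T.x k + T.d k + T.w k ∈ X

end Trace

end Iteration

/-- Bounds and Lipschitz constants of the problem functions, and the LICQ constant. -/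
structure Constants (m : ℕ) where
  kf : ℝ
  kg : ℝ
  kc : Fin m → ℝ
  kdc : Fin m → ℝ
  Lf : ℝ
  Lg : ℝ
  Lc : Fin m → ℝ
  Ldc : Fin m → ℝ
  kfh : ℝ
  Lfh : ℝ
  kch : Fin m → ℝ
  Lch : Fin m → ℝ
  gammaA : ℝ

/-- `h` is bounded in norm by `K` and Lipschitz continuous with constant `L` on `X`. -/
def BddLip {E F : Type*} [NormedAddCommGroup E] [NormedAddCommGroup F]
    (h : E → F) (X : Set E) (K L : ℝ) : Prop :=
  (∀ x ∈ X, ‖h x‖ ≤ K) ∧ ∀ x ∈ X, ∀ y ∈ X, ‖h x - h y‖ ≤ L * ‖x - y‖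

/-- The regularity assumptions on `X`, with their constants. -/
structure Regular {n m : ℕ} (Q : Problem n m) (X : Set (Vec n)) (C : Constants m) : Prop where
  f_contDiff : ContDiffOn ℝ 2 Q.f X
  c_contDiff : ContDiffOn ℝ 2 Q.c X
  f_bdd : BddLip Q.f X C.kf C.Lf
  g_bdd : BddLip (gradient Q.f) X C.kg C.Lg
  c_bdd : ∀ i, BddLip (Q.comp i) X (C.kc i) (C.Lc i)
  dc_bdd : ∀ i, BddLip (gradient (Q.comp i)) X (C.kdc i) (C.Ldc i)
  fh_bdd : BddLip (hess Q.f) X C.kfh C.Lfh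
  ch_bdd : ∀ i, BddLip (hess (Q.comp i)) X (C.kch i) (C.Lch i)
  /-- The smallest of the `m` singular values of the Jacobian is at least `γ_A > 0`. -/
  gammaA_pos : 0 < C.gammaA
  licq : ∀ x ∈ X, ∀ y : Vec m, C.gammaA * ‖y‖ ≤ ‖Q.AT x y‖

/-- The constant `κ_s`. -/
noncomputable def kappaS {n m : ℕ} (p : Params) (Q : Problem n m) (C : Constants m)
    (x0 : Vec n) (flow muMax : ℝ) (alpha : Fin 4 → ℝ) : ℝ :=
  (Q.f x0 - flow + 2 * (∑ i, C.kc i) * muMax) / (p.eta1 * ⨅ i, alpha i)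

/-- The constant `κ̃_s`. -/
noncomputable def kappaSt (p : Params) (ks sigmaMax : ℝ) : ℝ :=
  (Real.log p.gamma1 - Real.log p.gamma3) * ks + sigmaMax / p.sigma0

/-- `max {ε_g^(-3/2), ε_c^(-1), ε_H^(-3)}`. -/
noncomputable def rate (epsg epsc epsH : ℝ) : ℝ :=
  max (epsg ^ (-(3 / 2) : ℝ)) (max (epsc ^ (-1 : ℝ)) (epsH ^ (-3 : ℝ)))

end SCP

/-!
Every step is measured against the predicted reduction `Δq` of the merit model.

*Lower bound for the model.* The gradient and curvature conditions on the tangential step give a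
reduction of at least `(1/6 - δ) σ ‖u‖³` (`tangential_reduction_ge`), and the merit parameter is
chosen so that the normal step contributes at least `τ μ β ‖c‖₁` (`redq_ge`). Hence `Δq > 0`
unless the iterate is stationary (`redq_pos`). Since `√σ ‖v‖ ≤ 1` and `√σ ‖u‖` is bounded, the
trial merit parameter is bounded as well (`muC_le`, `muPrev_le_meritBound`).

*Success for large `σ`.* Far from feasibility, `Δq` is at least a multiple of `1/√σ`, while the
model error is `O(‖d‖²) = O(1/σ)` (`merit_sub_trial_ge`). Close to feasibility `β = 1`, so the
corrected step violates the constraints only by `O(‖d‖³)`; by the approximate least-squares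
multipliers, along the correction the objective changes like the curvature part of the Lagrangian,
so the error is `O(‖d‖³)` and the term `σ ‖d‖³ / 3` absorbs it (`merit_sub_corrected_ge`). Thus `σ`
is increased only below a fixed threshold (`successful_of_sigmaThreshold_le`, `sigma_le`).

*Decrease per success.* Let `j` and `k` be consecutive successful iterations, `k` nonstationary. A
large constraint violation or negative curvature at `k` forces `Δq_k` to be large. A large gradient
of the Lagrangian at `k` forces `‖u_j‖² + ‖v_j‖² + ‖v_k‖` to be large (`norm_gradLag_le`). In all
cases `Δq_j + Δq_k` is at least a multiple of the reciprocal of the rate (`decreaseRate_mul_le`).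

*Counting.* The merit function telescopes (`eta1_mul_sum_redq_le`), which bounds the number of
successful iterations up to the last one (`card_sub_one_le`); the growth of `σ` at unsuccessful
iterations bounds all iterations (`mul_log_gamma1_le`). The constants `α_i` and `σ*` are free:
`α_i` is taken small enough to make up for the factor `1 / log γ₁`, and `σ*` large enough for
`σ_max / σ_0` to dominate `log (σ_max / σ_0)` and the contribution of the last successful iteration.
-/

namespace SCP

/-! ### The `ℓ¹` norm -/

lemma l1_nonneg {m : ℕ} (y : Vec m) : 0 ≤ l1 y := Finset.sum_nonneg fun _ _ => abs_nonneg _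

@[simp] lemma l1_zero {m : ℕ} : l1 (0 : Vec m) = 0 := by simp [l1]

lemma l1_add_le {m : ℕ} (y z : Vec m) : l1 (y + z) ≤ l1 y + l1 z := by
  unfold l1
  rw [← Finset.sum_add_distrib]
  exact Finset.sum_le_sum fun i _ => abs_add_le _ _

lemma l1_smul {m : ℕ} (a : ℝ) (y : Vec m) : l1 (a • y) = |a| * l1 y := by
  simp [l1, abs_mul, Finset.mul_sum]

lemma l1_neg {m : ℕ} (y : Vec m) : l1 (-y) = l1 y := by simp [l1]

lemma l1_sub_le {m : ℕ} (y z : Vec m) : l1 (y - z) ≤ l1 y + l1 z := by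
  rw [sub_eq_add_neg, ← l1_neg z]
  exact l1_add_le _ _

lemma norm_le_l1 {m : ℕ} (y : Vec m) : ‖y‖ ≤ l1 y := by
  rw [EuclideanSpace.norm_eq]
  refine Real.sqrt_le_iff.2 ⟨l1_nonneg y, ?_⟩
  unfold l1
  exact Finset.sum_sq_le_sq_sum_of_nonneg fun i _ => norm_nonneg _

lemma l1_le_card_mul_norm {m : ℕ} (y : Vec m) : l1 y ≤ m * ‖y‖ := by
  calc l1 y ≤ ∑ _i : Fin m, ‖y‖ := Finset.sum_le_sum fun i _ => PiLp.norm_apply_le y i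
    _ = m * ‖y‖ := by simp

lemma eq_zero_of_l1_eq_zero {m : ℕ} {y : Vec m} (h : l1 y = 0) : y = 0 :=
  norm_le_zero_iff.1 (h ▸ norm_le_l1 y)

lemma l1_pos {m : ℕ} {y : Vec m} (h : y ≠ 0) : 0 < l1 y :=
  (norm_pos_iff.2 h).trans_le (norm_le_l1 y)

lemma abs_inner_le_l1 {m : ℕ} (y z : Vec m) : |inner ℝ y z| ≤ ‖y‖ * l1 z :=
  (abs_real_inner_le_norm y z).trans (by gcongr; exact norm_le_l1 z)

/-! ### Operators whose adjoint is bounded below -/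

section Adjoint

variable {n m : ℕ} {A : Vec n →L[ℝ] Vec m} {K : ℝ}

lemma norm_le_of_mem_range_adjoint (hK : ∀ y, ‖y‖ ≤ K * ‖A.adjoint y‖) {v : Vec n}
    (hv : v ∈ A.adjoint.range) : ‖v‖ ≤ K * ‖A v‖ := by
  obtain ⟨y, rfl⟩ := hv
  change ‖A.adjoint y‖ ≤ K * ‖A (A.adjoint y)‖
  rcases (norm_nonneg (A.adjoint y)).eq_or_lt with h | h
  · rw [← h, norm_eq_zero.1 h.symm]; simp
  · have h1 : ‖A.adjoint y‖ ^ 2 = inner ℝ y (A (A.adjoint y)) := by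
      rw [← ContinuousLinearMap.adjoint_inner_left, real_inner_self_eq_norm_sq]
    have h2 := real_inner_le_norm y (A (A.adjoint y))
    have h3 := mul_le_mul_of_nonneg_right (hK y) (norm_nonneg (A (A.adjoint y)))
    nlinarith

lemma norm_le_sq_of_adjoint (hK0 : 0 ≤ K) (hK : ∀ y, ‖y‖ ≤ K * ‖A.adjoint y‖) (y : Vec m) :
    ‖y‖ ≤ K ^ 2 * ‖A (A.adjoint y)‖ := by
  have h := norm_le_of_mem_range_adjoint hK (v := A.adjoint y) ⟨y, rfl⟩
  calc ‖y‖ ≤ K * ‖A.adjoint y‖ := hK y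
    _ ≤ K * (K * ‖A (A.adjoint y)‖) := by gcongr
    _ = _ := by ring

lemma mem_range_adjoint_of_orthogonal {z : Vec n} (hz : z ∈ (A.ker)ᗮ) : z ∈ A.adjoint.range := by
  rw [ContinuousLinearMap.orthogonal_ker, IsClosed.submodule_topologicalClosure_eq] at hz
  · exact hz
  · exact Submodule.closed_of_finiteDimensional _

lemma inner_eq_zero_of_range_adjoint_of_ker {v u : Vec n} (hv : v ∈ A.adjoint.range)
    (hu : A u = 0) : inner ℝ v u = 0 := by
  obtain ⟨y, rfl⟩ := hv
  change inner ℝ (A.adjoint y) u = 0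
  rw [ContinuousLinearMap.adjoint_inner_left, hu, inner_zero_right]

end Adjoint

/-! ### The smallest eigenvalue -/

section MinEig

variable {V : Type*} [NormedAddCommGroup V] [InnerProductSpace ℝ V]

lemma le_of_hasEigenvalue {B : V →L[ℝ] V} {t s : ℝ} (h : ∀ u, s * ‖u‖ ^ 2 ≤ inner ℝ u (B u))
    (ht : Module.End.HasEigenvalue (B : V →ₗ[ℝ] V) t) : s ≤ t := by
  obtain ⟨u, hu⟩ := ht.exists_hasEigenvector
  have h1 : B u = t • u := hu.apply_eq_smul
  have h2 := h u
  rw [h1, inner_smul_right, real_inner_self_eq_norm_sq] at h2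
  have : 0 < ‖u‖ := norm_pos_iff.2 hu.2
  exact le_of_mul_le_mul_right h2 (by positivity)

/-- The bound `s ≤ 0` takes care of the zero space, on which `minEig` vanishes. -/
lemma le_minEig {B : V →L[ℝ] V} {s : ℝ} (hs : s ≤ 0) (h : ∀ u, s * ‖u‖ ^ 2 ≤ inner ℝ u (B u)) :
    s ≤ minEig B := by
  rcases Set.eq_empty_or_nonempty {t : ℝ | Module.End.HasEigenvalue (B : V →ₗ[ℝ] V) t} with h0 | h0
  · rw [minEig, h0, Real.sInf_empty]; exact hs
  · exact le_csInf h0 fun t ht => le_of_hasEigenvalue h ht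

lemma minEig_mul_norm_sq_le [FiniteDimensional ℝ V] {B : V →L[ℝ] V}
    (hB : ∀ u w, inner ℝ (B u) w = inner ℝ u (B w)) (u : V) :
    minEig B * ‖u‖ ^ 2 ≤ inner ℝ u (B u) := by
  rcases subsingleton_or_nontrivial V with hV | hV
  · rw [Subsingleton.elim u 0]; simp
  have hlow : ∀ w, -‖B‖ * ‖w‖ ^ 2 ≤ inner ℝ w (B w) := fun w => by
    have h1 := (abs_le.1 (abs_real_inner_le_norm w (B w))).1
    have h2 := mul_le_mul_of_nonneg_left (B.le_opNorm w) (norm_nonneg w)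
    nlinarith
  rcases eq_or_ne u 0 with rfl | hu
  · simp
  have hsymm : (B : V →ₗ[ℝ] V).IsSymmetric := fun a b => hB a b
  have h1 := hsymm.hasEigenvalue_iInf_of_finiteDimensional
  have h2 : minEig B ≤ ⨅ x : { x : V // x ≠ 0 }, inner ℝ (B x) (x : V) / ‖(x : V)‖ ^ 2 :=
    csInf_le ⟨-‖B‖, fun t ht => le_of_hasEigenvalue hlow ht⟩ h1
  have h3 : (⨅ x : { x : V // x ≠ 0 }, inner ℝ (B x) (x : V) / ‖(x : V)‖ ^ 2)
      ≤ inner ℝ (B u) u / ‖u‖ ^ 2 := by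
    refine ciInf_le (f := fun x : { x : V // x ≠ 0 } => inner ℝ (B x) (x : V) / ‖(x : V)‖ ^ 2)
      ⟨-‖B‖, ?_⟩ ⟨u, hu⟩
    rintro _ ⟨⟨w, hw⟩, rfl⟩
    have := norm_pos_iff.2 hw
    simp only
    rw [le_div_iff₀ (by positivity), hB]
    exact hlow w
  have := norm_pos_iff.2 hu
  rw [← hB, ← le_div_iff₀ (by positivity)]
  exact h2.trans h3

end MinEig

/-! ### Taylor estimates -/

section Taylor

variable {n : ℕ} {h : Vec n → ℝ} {X : Set (Vec n)}

lemma BddLip.mono {E F : Type*} [NormedAddCommGroup E] [NormedAddCommGroup F] {φ : E → F}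
    {S : Set E} {K L K' L' : ℝ} (hφ : BddLip φ S K L) (hK : K ≤ K') (hL : L ≤ L') :
    BddLip φ S K' L' :=
  ⟨fun x hx => (hφ.1 x hx).trans hK,
    fun x hx y hy => (hφ.2 x hx y hy).trans (by gcongr)⟩

lemma hasGradientAt_of_contDiffOn (hX : IsOpen X) (hh : ContDiffOn ℝ 2 h X) {x : Vec n}
    (hx : x ∈ X) : HasGradientAt h (gradient h x) x :=
  ((hh.contDiffAt (hX.mem_nhds hx)).differentiableAt (by norm_num)).hasGradientAt

lemma gradient_eq_toDual_symm_comp :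
    gradient h = fun x => (InnerProductSpace.toDual ℝ (Vec n)).symm (fderiv ℝ h x) := rfl

lemma differentiableAt_fderiv_of_contDiffOn (hX : IsOpen X) (hh : ContDiffOn ℝ 2 h X) {x : Vec n}
    (hx : x ∈ X) : DifferentiableAt ℝ (fderiv ℝ h) x :=
  ((hh.contDiffAt (hX.mem_nhds hx)).fderiv_right (m := 1) (by norm_num)).differentiableAt
    (by norm_num)

lemma hasFDerivAt_gradient (hX : IsOpen X) (hh : ContDiffOn ℝ 2 h X) {x : Vec n}
    (hx : x ∈ X) : HasFDerivAt (gradient h) (hess h x) x := by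
  refine DifferentiableAt.hasFDerivAt ?_
  rw [gradient_eq_toDual_symm_comp]
  exact ((InnerProductSpace.toDual ℝ (Vec n)).symm.toContinuousLinearEquiv.differentiableAt).comp x
    (differentiableAt_fderiv_of_contDiffOn hX hh hx)

lemma inner_hess (hX : IsOpen X) (hh : ContDiffOn ℝ 2 h X) {x : Vec n} (hx : x ∈ X)
    (u w : Vec n) : inner ℝ (hess h x u) w = fderiv ℝ (fderiv ℝ h) x u w := by
  have h1 : HasFDerivAt (fun y => inner ℝ (gradient h y) w) _ x :=
    (hasFDerivAt_gradient hX hh hx).inner ℝ (hasFDerivAt_const w x)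
  have h2 : HasFDerivAt (fun y => fderiv ℝ h y w) _ x :=
    (differentiableAt_fderiv_of_contDiffOn hX hh hx).hasFDerivAt.clm_apply (hasFDerivAt_const w x)
  simp only [inner_gradient_left] at h1
  have h3 := congrArg (fun φ => φ u) (h1.unique h2)
  simpa [fderivInnerCLM_apply] using h3

lemma hess_symm (hX : IsOpen X) (hh : ContDiffOn ℝ 2 h X) {x : Vec n} (hx : x ∈ X)
    (u w : Vec n) : inner ℝ (hess h x u) w = inner ℝ u (hess h x w) := by
  rw [real_inner_comm, real_inner_comm _ u, real_inner_comm, inner_hess hX hh hx,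
    inner_hess hX hh hx]
  exact ((hh.contDiffAt (hX.mem_nhds hx)).isSymmSndFDerivAt (by simp)) u w

lemma segment_mem (hXc : Convex ℝ X) {x y : Vec n} (hx : x ∈ X) (hy : y ∈ X) {t : ℝ}
    (ht : t ∈ Set.Icc (0 : ℝ) 1) : x + t • (y - x) ∈ X :=
  hXc.add_smul_sub_mem hx hy ht

lemma norm_gradient_taylor_le (hX : IsOpen X) (hXc : Convex ℝ X) (hh : ContDiffOn ℝ 2 h X)
    {K L : ℝ} (hL0 : 0 ≤ L) (hL : BddLip (hess h) X K L) {x y : Vec n} (hx : x ∈ X) (hy : y ∈ X) :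
    ‖gradient h y - gradient h x - hess h x (y - x)‖ ≤ L * ‖y - x‖ ^ 2 := by
  have hseg := hXc.segment_subset hx hy
  refine ((convex_segment x y).norm_image_sub_le_of_norm_hasFDerivWithin_le' (f' := hess h)
    (φ := hess h x) (C := L * ‖y - x‖) (fun z hz =>
      (hasFDerivAt_gradient hX hh (hseg hz)).hasFDerivWithinAt) (fun z hz => ?_)
    (left_mem_segment ℝ x y) (right_mem_segment ℝ x y)).trans_eq (by ring)
  refine (hL.2 z (hseg hz) x hx).trans ?_
  gcongr
  have := norm_sub_le_of_mem_segment hz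
  rw [norm_sub_rev y x]
  simpa [norm_sub_rev] using this

lemma hasDerivAt_line (hX : IsOpen X) (hh : ContDiffOn ℝ 2 h X) {x s : Vec n} {t : ℝ}
    (hz : x + t • s ∈ X) :
    HasDerivAt (fun t : ℝ => h (x + t • s)) (inner ℝ (gradient h (x + t • s)) s) t := by
  have h1 : HasDerivAt (fun t : ℝ => x + t • s) s t := by
    simpa using ((hasDerivAt_id t).smul_const s).const_add x
  have h2 := (hasGradientAt_of_contDiffOn hX hh hz).hasFDerivAt.comp_hasDerivAt t h1
  rw [← InnerProductSpace.toDual_apply_apply]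
  exact h2

lemma abs_taylor_one_le (hX : IsOpen X) (hXc : Convex ℝ X) (hh : ContDiffOn ℝ 2 h X)
    {K L : ℝ} (hL0 : 0 ≤ L) (hL : BddLip (gradient h) X K L) {x y : Vec n} (hx : x ∈ X)
    (hy : y ∈ X) :
    |h y - h x - inner ℝ (gradient h x) (y - x)| ≤ L * ‖y - x‖ ^ 2 := by
  obtain ⟨s, rfl⟩ : ∃ s, y = x + s := ⟨y - x, by simp⟩
  have hseg : ∀ t ∈ Set.Icc (0 : ℝ) 1, x + t • s ∈ X := fun t ht => by
    simpa using segment_mem hXc hx hy ht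
  rw [add_sub_cancel_left]
  have h1 : ∀ t ∈ Set.Icc (0 : ℝ) 1, HasDerivWithinAt
      (fun t : ℝ => h (x + t • s) - t * inner ℝ (gradient h x) s)
      (inner ℝ (gradient h (x + t • s)) s - inner ℝ (gradient h x) s) (Set.Icc 0 1) t := by
    intro t ht
    have := (hasDerivAt_line hX hh (hseg t ht)).sub
      ((hasDerivAt_id t).mul_const (inner ℝ (gradient h x) s))
    exact (this.congr_deriv (by ring)).hasDerivWithinAt
  have h2 := (convex_Icc (0 : ℝ) 1).norm_image_sub_le_of_norm_hasDerivWithin_le h1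
    (C := L * ‖s‖ ^ 2) (fun t ht => ?_) (Set.left_mem_Icc.2 zero_le_one)
    (Set.right_mem_Icc.2 zero_le_one)
  · simp only [one_smul, zero_smul, add_zero, one_mul, zero_mul, sub_zero, norm_one, mul_one,
      Real.norm_eq_abs] at h2
    convert h2 using 2
    ring
  · rw [← inner_sub_left]
    refine (norm_inner_le_norm _ _).trans ?_
    have h3 := hL.2 _ (hseg t ht) x hx
    rw [add_sub_cancel_left, norm_smul, Real.norm_of_nonneg ht.1] at h3
    calc _ ≤ L * (t * ‖s‖) * ‖s‖ := by gcongr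
      _ ≤ L * (1 * ‖s‖) * ‖s‖ := by gcongr; exact ht.2
      _ = _ := by ring

lemma abs_taylor_two_le (hX : IsOpen X) (hXc : Convex ℝ X) (hh : ContDiffOn ℝ 2 h X)
    {K L : ℝ} (hL0 : 0 ≤ L) (hL : BddLip (hess h) X K L) {x y : Vec n} (hx : x ∈ X)
    (hy : y ∈ X) :
    |h y - h x - inner ℝ (gradient h x) (y - x) - 1 / 2 * inner ℝ (y - x) (hess h x (y - x))|
      ≤ L * ‖y - x‖ ^ 3 := by
  obtain ⟨s, rfl⟩ : ∃ s, y = x + s := ⟨y - x, by simp⟩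
  have hseg : ∀ t ∈ Set.Icc (0 : ℝ) 1, x + t • s ∈ X := fun t ht => by
    simpa using segment_mem hXc hx hy ht
  rw [add_sub_cancel_left]
  have h1 : ∀ t ∈ Set.Icc (0 : ℝ) 1, HasDerivWithinAt
      (fun t : ℝ => h (x + t • s) - t * inner ℝ (gradient h x) s
        - t ^ 2 * (1 / 2 * inner ℝ s (hess h x s)))
      (inner ℝ (gradient h (x + t • s)) s - inner ℝ (gradient h x) s
        - t * inner ℝ s (hess h x s)) (Set.Icc 0 1) t := by
    intro t ht
    have := ((hasDerivAt_line hX hh (hseg t ht)).sub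
      ((hasDerivAt_id t).mul_const (inner ℝ (gradient h x) s))).sub
      ((hasDerivAt_pow 2 t).mul_const (1 / 2 * inner ℝ s (hess h x s)))
    exact (this.congr_deriv (by push_cast; ring)).hasDerivWithinAt
  have h2 := (convex_Icc (0 : ℝ) 1).norm_image_sub_le_of_norm_hasDerivWithin_le h1
    (C := L * ‖s‖ ^ 3) (fun t ht => ?_) (Set.left_mem_Icc.2 zero_le_one)
    (Set.right_mem_Icc.2 zero_le_one)
  · simp only [one_smul, zero_smul, add_zero, one_mul, zero_mul, sub_zero, norm_one, mul_one,
      Real.norm_eq_abs, one_pow, ne_eq, OfNat.ofNat_ne_zero, not_false_eq_true,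
      zero_pow] at h2
    convert h2 using 2
    ring
  · have h3 := norm_gradient_taylor_le hX hXc hh hL0 hL hx (hseg t ht)
    rw [add_sub_cancel_left, norm_smul, Real.norm_of_nonneg ht.1] at h3
    have h4 : inner ℝ (gradient h (x + t • s)) s - inner ℝ (gradient h x) s
        - t * inner ℝ s (hess h x s)
        = inner ℝ (gradient h (x + t • s) - gradient h x - hess h x (t • s)) s := by
      rw [inner_sub_left, inner_sub_left, map_smul, real_inner_smul_left,
        real_inner_comm s (hess h x s)]
    rw [h4]
    refine (norm_inner_le_norm _ _).trans ?_
    calc _ ≤ L * (t * ‖s‖) ^ 2 * ‖s‖ := by gcongr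
      _ ≤ L * (1 * ‖s‖) ^ 2 * ‖s‖ := by gcongr; exacts [mul_nonneg ht.1 (norm_nonneg _), ht.2]
      _ = _ := by ring

end Taylor

/-! ### Uniform bounds for the problem functions -/

/-- All bounds that the analysis uses, with one common constant `K`: bounds on the data, Taylor
estimates for the objective, the constraints and the Lagrangian, and the lower bound for the
transposed Jacobian. -/
structure SmoothBounds {n m : ℕ} (Q : Problem n m) (X : Set (Vec n)) (K : ℝ) : Prop where
  one_le : 1 ≤ K
  adj : ∀ x ∈ X, ∀ y, ‖y‖ ≤ K * ‖(Q.A x).adjoint y‖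
  c_le : ∀ x ∈ X, l1 (Q.c x) ≤ K
  grad_le : ∀ x ∈ X, ‖gradient Q.f x‖ ≤ K
  A_le : ∀ x ∈ X, ∀ z, ‖Q.A x z‖ ≤ K * ‖z‖
  H_le : ∀ x ∈ X, ∀ lam z, ‖Q.H x lam z‖ ≤ K * (1 + ‖lam‖) * ‖z‖
  H_symm : ∀ x ∈ X, ∀ lam u w, inner ℝ (Q.H x lam u) w = inner ℝ u (Q.H x lam w)
  gradLag_eq : ∀ x ∈ X, ∀ lam, Q.gradLag x lam = gradient Q.f x + (Q.A x).adjoint lam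
  grad_lip : ∀ x ∈ X, ∀ y ∈ X, ‖gradient Q.f y - gradient Q.f x‖ ≤ K * ‖y - x‖
  A_lip : ∀ x ∈ X, ∀ y ∈ X, ∀ z, ‖Q.A y z - Q.A x z‖ ≤ K * ‖y - x‖ * ‖z‖
  adj_lip : ∀ x ∈ X, ∀ y ∈ X, ∀ lam,
    ‖(Q.A y).adjoint lam - (Q.A x).adjoint lam‖ ≤ K * ‖y - x‖ * ‖lam‖
  f_taylor : ∀ x ∈ X, ∀ y ∈ X,
    |Q.f y - Q.f x - inner ℝ (gradient Q.f x) (y - x)| ≤ K * ‖y - x‖ ^ 2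
  c_taylor : ∀ x ∈ X, ∀ y ∈ X, l1 (Q.c y - Q.c x - Q.A x (y - x)) ≤ K * ‖y - x‖ ^ 2
  lag_taylor : ∀ x ∈ X, ∀ y ∈ X, ∀ lam,
    |Q.f y - Q.f x - inner ℝ (gradient Q.f x) (y - x)
      + inner ℝ lam (Q.c y - Q.c x - Q.A x (y - x))
      - 1 / 2 * inner ℝ (y - x) (Q.H x lam (y - x))| ≤ K * (1 + ‖lam‖) * ‖y - x‖ ^ 3
  grad_taylor : ∀ x ∈ X, ∀ y ∈ X, ∀ lam,
    ‖(gradient Q.f y + (Q.A y).adjoint lam) - (gradient Q.f x + (Q.A x).adjoint lam)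
      - Q.H x lam (y - x)‖ ≤ K * (1 + ‖lam‖) * ‖y - x‖ ^ 2

/-- A common majorant of the constants of the problem. -/
noncomputable def Constants.bound {m : ℕ} (C : Constants m) : ℝ :=
  1 + |C.gammaA⁻¹| + |C.kg| + |C.kfh| + |C.Lg| + |C.Lfh| + ∑ i, |C.kc i| + ∑ i, |C.kdc i|
    + ∑ i, |C.kch i| + ∑ i, |C.Ldc i| + ∑ i, |C.Lch i|

lemma Constants.one_le_bound {m : ℕ} (C : Constants m) : 1 ≤ C.bound := by
  have h : 0 ≤ |C.gammaA⁻¹| + |C.kg| + |C.kfh| + |C.Lg| + |C.Lfh| + ∑ i, |C.kc i|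
    + ∑ i, |C.kdc i| + ∑ i, |C.kch i| + ∑ i, |C.Ldc i| + ∑ i, |C.Lch i| := by positivity
  unfold Constants.bound
  linarith

lemma norm_sum_smul_le {m : ℕ} {F : Type*} [NormedAddCommGroup F] [NormedSpace ℝ F]
    (lam : Vec m) {z : Fin m → F} {a : Fin m → ℝ} {b : ℝ} (hb : 0 ≤ b)
    (hz : ∀ i, ‖z i‖ ≤ a i * b) : ‖∑ i, lam i • z i‖ ≤ ‖lam‖ * ((∑ i, |a i|) * b) := by
  rw [Finset.sum_mul, Finset.mul_sum]
  refine (norm_sum_le _ _).trans (Finset.sum_le_sum fun i _ => ?_)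
  rw [norm_smul]
  exact mul_le_mul (PiLp.norm_apply_le lam i)
    ((hz i).trans (mul_le_mul_of_nonneg_right (le_abs_self _) hb)) (norm_nonneg _) (norm_nonneg _)

lemma l1_le_of_forall_abs_le {m : ℕ} {y : Vec m} {a : Fin m → ℝ} {b : ℝ} (hb : 0 ≤ b)
    (hy : ∀ i, |y i| ≤ a i * b) : l1 y ≤ (∑ i, |a i|) * b := by
  rw [Finset.sum_mul]
  exact Finset.sum_le_sum fun i _ =>
    (hy i).trans (mul_le_mul_of_nonneg_right (le_abs_self _) hb)

namespace Regular

variable {n m : ℕ} {Q : Problem n m} {X : Set (Vec n)} {C : Constants m}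

lemma comp_contDiff (hQ : Regular Q X C) (i : Fin m) : ContDiffOn ℝ 2 (Q.comp i) X :=
  contDiffOn_euclidean.1 hQ.c_contDiff i

lemma hasFDerivAt_c (hX : IsOpen X) (hQ : Regular Q X C) {x : Vec n} (hx : x ∈ X) :
    HasFDerivAt Q.c (Q.A x) x :=
  ((hQ.c_contDiff.contDiffAt (hX.mem_nhds hx)).differentiableAt (by norm_num)).hasFDerivAt

lemma A_apply (hX : IsOpen X) (hQ : Regular Q X C) {x : Vec n} (hx : x ∈ X) (z : Vec n)
    (i : Fin m) : Q.A x z i = inner ℝ (gradient (Q.comp i) x) z := by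
  rw [inner_gradient_left]
  have h1 : HasFDerivAt (Q.comp i) ((EuclideanSpace.proj i : Vec m →L[ℝ] ℝ) ∘L Q.A x) x :=
    (EuclideanSpace.proj i : Vec m →L[ℝ] ℝ).hasFDerivAt.comp x (hQ.hasFDerivAt_c hX hx)
  rw [h1.fderiv]
  rfl

lemma inner_eq_sum {m : ℕ} (y z : Vec m) : inner ℝ y z = ∑ i, y i * z i := by
  simp [PiLp.inner_apply, mul_comm]

lemma adjoint_apply (hX : IsOpen X) (hQ : Regular Q X C) {x : Vec n} (hx : x ∈ X) (lam : Vec m) :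
    (Q.A x).adjoint lam = ∑ i, lam i • gradient (Q.comp i) x := by
  refine ext_inner_right ℝ fun z => ?_
  rw [ContinuousLinearMap.adjoint_inner_left, inner_eq_sum, sum_inner]
  refine Finset.sum_congr rfl fun i _ => ?_
  rw [hQ.A_apply hX hx, real_inner_smul_left]

lemma gradLag_eq (hX : IsOpen X) (hQ : Regular Q X C) {x : Vec n} (hx : x ∈ X) (lam : Vec m) :
    Q.gradLag x lam = gradient Q.f x + (Q.A x).adjoint lam := by
  refine HasGradientAt.gradient ?_
  rw [hasGradientAt_iff_hasFDerivAt]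
  have h1 := (hasGradientAt_of_contDiffOn hX hQ.f_contDiff hx).hasFDerivAt
  have h2 := (hasFDerivAt_const lam x).inner ℝ (hQ.hasFDerivAt_c hX hx)
  refine (h1.add h2).congr_fderiv ?_
  ext z
  simp [fderivInnerCLM_apply, ContinuousLinearMap.adjoint_inner_left]

/-- The regularity assumptions yield the uniform bounds. -/
lemma smoothBounds (hX : IsOpen X) (hXc : Convex ℝ X) (hQ : Regular Q X C) :
    SmoothBounds Q X C.bound := by
  have e1 := abs_nonneg C.gammaA⁻¹
  have e2 := abs_nonneg C.kg
  have e3 := abs_nonneg C.kfh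
  have e4 := abs_nonneg C.Lg
  have e5 := abs_nonneg C.Lfh
  have es : ∀ a : Fin m → ℝ, 0 ≤ ∑ i, |a i| := fun a => Finset.sum_nonneg fun _ _ => abs_nonneg _
  have e6 := es C.kc
  have e7 := es C.kdc
  have e8 := es C.kch
  have e9 := es C.Ldc
  have e10 := es C.Lch
  have b0 : 0 ≤ C.bound := zero_le_one.trans C.one_le_bound
  have gB := hQ.g_bdd.mono (le_abs_self _) (le_abs_self _)
  have hB := hQ.fh_bdd.mono (le_abs_self _) (le_abs_self _)
  have cB := fun i => (hQ.ch_bdd i).mono (le_abs_self _) (le_abs_self _)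
  have dB := fun i => (hQ.dc_bdd i).mono (le_abs_self _) (le_abs_self _)
  have key : ∀ {a b lam t : ℝ}, a + b ≤ C.bound → 0 ≤ a → 0 ≤ b → 0 ≤ lam → 0 ≤ t →
      a * t + lam * (b * t) ≤ C.bound * (1 + lam) * t := by
    intro a b lam t h ha hb hl ht
    have h1 : a * t ≤ C.bound * t := by gcongr; linarith
    have h2 : lam * (b * t) ≤ lam * (C.bound * t) := by gcongr; linarith
    linarith
  refine ⟨?_, ?_, ?_, ?_, ?_, ?_, ?_, ?_, ?_, ?_, ?_, ?_, ?_, ?_, ?_⟩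
  · exact C.one_le_bound
  · intro x hx y
    have h1 := hQ.licq x hx y
    have h2 : ‖y‖ ≤ C.gammaA⁻¹ * ‖(Q.A x).adjoint y‖ := by
      rw [inv_mul_eq_div, le_div_iff₀ hQ.gammaA_pos, mul_comm]
      exact h1
    refine h2.trans ?_
    gcongr
    have := le_abs_self C.gammaA⁻¹
    unfold Constants.bound; linarith
  · intro x hx
    have h1 : l1 (Q.c x) ≤ (∑ i, |C.kc i|) * 1 :=
      l1_le_of_forall_abs_le zero_le_one fun i => by
        rw [mul_one]; exact (hQ.c_bdd i).1 x hx
    unfold Constants.bound; linarith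
  · intro x hx
    refine (gB.1 x hx).trans ?_
    unfold Constants.bound; linarith
  · intro x hx z
    refine (norm_le_l1 _).trans ((l1_le_of_forall_abs_le (a := C.kdc) (norm_nonneg z)
      fun i => ?_).trans ?_)
    · rw [hQ.A_apply hX hx]
      exact (abs_real_inner_le_norm _ _).trans (by gcongr; exact (hQ.dc_bdd i).1 x hx)
    · gcongr
      unfold Constants.bound; linarith
  · intro x hx lam z
    have h1 : Q.H x lam z = hess Q.f x z + ∑ i, lam i • hess (Q.comp i) x z := by
      simp [Problem.H]
    rw [h1]
    refine (norm_add_le _ _).trans ((add_le_add (((hess Q.f x).le_opNorm z).trans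
      (mul_le_mul_of_nonneg_right (hB.1 x hx) (norm_nonneg z)))
      (norm_sum_smul_le lam (a := C.kch) (norm_nonneg z) fun i =>
        ((hess (Q.comp i) x).le_opNorm z).trans (mul_le_mul_of_nonneg_right
        ((hQ.ch_bdd i).1 x hx) (norm_nonneg z)))).trans ?_)
    exact key (by unfold Constants.bound; linarith) e3 e8 (norm_nonneg _) (norm_nonneg _)
  · intro x hx lam u w
    have h1 : ∀ z, Q.H x lam z = hess Q.f x z + ∑ i, lam i • hess (Q.comp i) x z := by
      intro z; simp [Problem.H]
    rw [h1, h1, inner_add_left, inner_add_right, sum_inner, inner_sum,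
      hess_symm hX hQ.f_contDiff hx]
    congr 1
    refine Finset.sum_congr rfl fun i _ => ?_
    rw [real_inner_smul_left, real_inner_smul_right, hess_symm hX (hQ.comp_contDiff i) hx]
  · intro x hx lam
    exact hQ.gradLag_eq hX hx lam
  · intro x hx y hy
    refine (gB.2 y hy x hx).trans ?_
    gcongr
    unfold Constants.bound; linarith
  · intro x hx y hy z
    refine (norm_le_l1 _).trans ((l1_le_of_forall_abs_le (a := C.Ldc)
      (mul_nonneg (norm_nonneg (y - x)) (norm_nonneg z)) fun i => ?_).trans ?_)
    · rw [PiLp.sub_apply, hQ.A_apply hX hx, hQ.A_apply hX hy, ← inner_sub_left, ← mul_assoc]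
      exact (abs_real_inner_le_norm _ _).trans (by gcongr; exact (hQ.dc_bdd i).2 y hy x hx)
    · rw [← mul_assoc]
      gcongr
      unfold Constants.bound; linarith
  · intro x hx y hy lam
    rw [hQ.adjoint_apply hX hx, hQ.adjoint_apply hX hy, ← Finset.sum_sub_distrib]
    simp_rw [← smul_sub]
    refine (norm_sum_smul_le lam (norm_nonneg (y - x)) fun i =>
      (hQ.dc_bdd i).2 y hy x hx).trans ?_
    rw [mul_comm]
    gcongr
    unfold Constants.bound; linarith
  · intro x hx y hy
    refine (abs_taylor_one_le hX hXc hQ.f_contDiff e4 gB hx hy).trans ?_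
    gcongr
    unfold Constants.bound; linarith
  · intro x hx y hy
    refine (l1_le_of_forall_abs_le (a := fun i => |C.Ldc i|) (sq_nonneg ‖y - x‖)
      fun i => ?_).trans ?_
    · rw [PiLp.sub_apply, PiLp.sub_apply, hQ.A_apply hX hx]
      exact abs_taylor_one_le hX hXc (hQ.comp_contDiff i) (abs_nonneg _) (dB i) hx hy
    · simp_rw [abs_abs]
      gcongr
      unfold Constants.bound; linarith
  · intro x hx y hy lam
    have h1 : Q.f y - Q.f x - inner ℝ (gradient Q.f x) (y - x)
        + inner ℝ lam (Q.c y - Q.c x - Q.A x (y - x))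
        - 1 / 2 * inner ℝ (y - x) (Q.H x lam (y - x))
        = (Q.f y - Q.f x - inner ℝ (gradient Q.f x) (y - x)
            - 1 / 2 * inner ℝ (y - x) (hess Q.f x (y - x)))
          + ∑ i, lam i • (Q.comp i y - Q.comp i x - inner ℝ (gradient (Q.comp i) x) (y - x)
            - 1 / 2 * inner ℝ (y - x) (hess (Q.comp i) x (y - x))) := by
      have h2 : Q.H x lam (y - x)
          = hess Q.f x (y - x) + ∑ i, lam i • hess (Q.comp i) x (y - x) := by
        simp only [Problem.H, add_apply, sum_apply, smul_apply]
      rw [h2, inner_add_right, inner_sum, inner_eq_sum lam]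
      simp_rw [real_inner_smul_right, PiLp.sub_apply, hQ.A_apply hX hx, smul_eq_mul, mul_sub,
        Finset.sum_sub_distrib]
      rw [mul_add, Finset.mul_sum]
      have h3 : ∀ i, lam i * (1 / 2 * inner ℝ (y - x) (hess (Q.comp i) x (y - x)))
          = 1 / 2 * (lam i * inner ℝ (y - x) (hess (Q.comp i) x (y - x))) := fun i => by ring
      simp_rw [h3, Problem.comp]
      ring
    rw [h1, ← Real.norm_eq_abs]
    refine (norm_add_le _ _).trans ((add_le_add
      (abs_taylor_two_le hX hXc hQ.f_contDiff e5 hB hx hy)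
      (norm_sum_smul_le lam (a := fun i => |C.Lch i|) (b := ‖y - x‖ ^ 3) (by positivity)
        fun i => abs_taylor_two_le hX hXc (hQ.comp_contDiff i) (abs_nonneg _) (cB i) hx hy)).trans
        ?_)
    simp_rw [abs_abs]
    exact key (by unfold Constants.bound; linarith) e5 e10 (norm_nonneg _) (by positivity)
  · intro x hx y hy lam
    have h1 : (gradient Q.f y + (Q.A y).adjoint lam) - (gradient Q.f x + (Q.A x).adjoint lam)
        - Q.H x lam (y - x)
        = (gradient Q.f y - gradient Q.f x - hess Q.f x (y - x))
          + ∑ i, lam i • (gradient (Q.comp i) y - gradient (Q.comp i) x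
            - hess (Q.comp i) x (y - x)) := by
      simp only [Problem.H, add_apply, sum_apply, smul_apply]
      rw [hQ.adjoint_apply hX hx, hQ.adjoint_apply hX hy]
      simp_rw [smul_sub, Finset.sum_sub_distrib]
      abel
    rw [h1]
    refine (norm_add_le _ _).trans ((add_le_add
      (norm_gradient_taylor_le hX hXc hQ.f_contDiff e5 hB hx hy)
      (norm_sum_smul_le lam (a := fun i => |C.Lch i|) (b := ‖y - x‖ ^ 2) (by positivity)
        fun i => norm_gradient_taylor_le hX hXc (hQ.comp_contDiff i) (abs_nonneg _) (cB i)
          hx hy)).trans ?_)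
    simp_rw [abs_abs]
    exact key (by unfold Constants.bound; linarith) e5 e10 (norm_nonneg _) (by positivity)

end Regular

/-! ### The steps of one iteration -/

/-- A run of the algorithm that stays in a set on which the uniform bounds hold. -/
structure RegularRun {n m : ℕ} (p : Params) (Q : Problem n m) (T : Trace n m) (X : Set (Vec n))
    (K epsg epsc epsH : ℝ) : Prop where
  bounds : SmoothBounds Q X K
  run : T.IsRun p Q epsg epsc epsH
  stays : T.StaysIn p Q X epsg epsc epsH

lemma Trace.Reached.mono {n m : ℕ} {Q : Problem n m} {T : Trace n m} {epsg epsc epsH : ℝ} {j k : ℕ}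
    (h : T.Reached Q epsg epsc epsH k) (hjk : j ≤ k) : T.Reached Q epsg epsc epsH j :=
  fun i hi => h i (hi.trans_le hjk)

namespace RegularRun

variable {n m : ℕ} {p : Params} {Q : Problem n m} {T : Trace n m} {X : Set (Vec n)}
  {K epsg epsc epsH : ℝ} {k : ℕ}

lemma K_pos (h : RegularRun p Q T X K epsg epsc epsH) : 0 < K :=
  zero_lt_one.trans_le h.bounds.one_le

lemma sigmaMin_le (h : RegularRun p Q T X K epsg epsc epsH) :
    ∀ k, T.Reached Q epsg epsc epsH k → p.sigmaMin ≤ T.sigma k := by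
  intro k
  induction k with
  | zero => intro _; rw [h.run.init]; exact p.sigmaMin_le
  | succ k ih =>
    intro hk
    have h1 := ih (hk.mono k.le_succ)
    have hs := h.run.sigma k hk
    by_cases hS : T.Successful p Q k
    · rcases lt_or_ge p.eta2 (T.ratio p Q k) with h2 | h2
      · exact (le_max_left _ _).trans (hs.verySuccessful hS h2).1
      · rw [hs.successful hS h2]; exact h1
    · have h2 := (hs.unsuccessful hS).1
      have := p.sigmaMin_pos
      have := p.gamma1_gt
      nlinarith

lemma sigma_pos (h : RegularRun p Q T X K epsg epsc epsH) (hk : T.Reached Q epsg epsc epsH k) :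
    0 < T.sigma k := p.sigmaMin_pos.trans_le (h.sigmaMin_le k hk)

section Normal

variable (h : RegularRun p Q T X K epsg epsc epsH) (hk : T.Reached Q epsg epsc epsH k)

include h hk

lemma x_mem : T.x k ∈ X := h.stays.iterate k hk

lemma residual_le_l1 : l1 (Q.A (T.x k) (T.vc k) + Q.c (T.x k)) ≤ p.rv * l1 (Q.c (T.x k)) :=
  (h.run.normal k hk).residual.trans
    (mul_le_mul_of_nonneg_left (min_le_left _ _) p.rv_nonneg)

lemma residual_le_cube : l1 (Q.A (T.x k) (T.vc k) + Q.c (T.x k)) ≤ p.rv * ‖T.vc k‖ ^ 3 :=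
  (h.run.normal k hk).residual.trans
    (mul_le_mul_of_nonneg_left (min_le_right _ _) p.rv_nonneg)

lemma norm_vc_le : ‖T.vc k‖ ≤ 2 * K * l1 (Q.c (T.x k)) := by
  have h1 := norm_le_of_mem_range_adjoint (h.bounds.adj _ (h.x_mem hk)) (h.run.normal k hk).vc_mem
  have h2 : l1 (Q.A (T.x k) (T.vc k)) ≤ 2 * l1 (Q.c (T.x k)) := by
    have h3 := l1_sub_le (Q.A (T.x k) (T.vc k) + Q.c (T.x k)) (Q.c (T.x k))
    rw [add_sub_cancel_right] at h3
    have h4 := h.residual_le_l1 hk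
    have h5 : p.rv ≤ 1 := by have := p.rv_lt; have := p.tau_pos; linarith
    have h6 := l1_nonneg (Q.c (T.x k))
    nlinarith
  have h3 := h.K_pos
  calc ‖T.vc k‖ ≤ K * ‖Q.A (T.x k) (T.vc k)‖ := h1
    _ ≤ K * (2 * l1 (Q.c (T.x k))) := by gcongr; exact (norm_le_l1 _).trans h2
    _ = _ := by ring

lemma vc_ne_zero (hc : Q.c (T.x k) ≠ 0) : T.vc k ≠ 0 := by
  intro h0
  have h1 := h.residual_le_cube hk
  rw [h0] at h1
  simp only [map_zero, zero_add, norm_zero, ne_eq, OfNat.ofNat_ne_zero, not_false_eq_true,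
    zero_pow, mul_zero] at h1
  exact absurd (l1_pos hc) (not_lt.2 h1)

lemma beta_pos : 0 < T.beta k := by
  by_cases hc : Q.c (T.x k) = 0
  · rw [((h.run.normal k hk).feasible hc).2]; exact one_pos
  · have h1 := norm_pos_iff.2 (h.vc_ne_zero hk hc)
    have h2 := Real.sqrt_pos.2 (h.sigma_pos hk)
    have h3 := p.theta_pos
    exact (lt_min one_pos (by positivity)).trans_le ((h.run.normal k hk).beta_ge hc)

lemma beta_le_one : T.beta k ≤ 1 := by
  by_cases hc : Q.c (T.x k) = 0
  · rw [((h.run.normal k hk).feasible hc).2]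
  · exact ((h.run.normal k hk).beta_le hc).trans (min_le_left _ _)

lemma norm_v_eq : ‖T.v k‖ = T.beta k * ‖T.vc k‖ := by
  rw [(h.run.normal k hk).v_eq, norm_smul, Real.norm_of_nonneg (h.beta_pos hk).le]

lemma sqrt_sigma_mul_norm_v_le : √(T.sigma k) * ‖T.v k‖ ≤ 1 := by
  have h2 := Real.sqrt_pos.2 (h.sigma_pos hk)
  rw [h.norm_v_eq hk]
  by_cases hc : Q.c (T.x k) = 0
  · rw [((h.run.normal k hk).feasible hc).1]; simp
  · have h1 := norm_pos_iff.2 (h.vc_ne_zero hk hc)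
    have h3 := ((h.run.normal k hk).beta_le hc).trans (min_le_right _ _)
    rw [le_div_iff₀ (by positivity)] at h3
    linarith

/-- Damping by `β` shortens `vᶜ` only if `√σ ‖vᶜ‖` exceeds `θ`, and then at most to `θ`. -/
lemma min_le_sqrt_sigma_mul_norm_v (hc : Q.c (T.x k) ≠ 0) :
    min (√(T.sigma k) * ‖T.vc k‖) p.theta ≤ √(T.sigma k) * ‖T.v k‖ := by
  have h2 := Real.sqrt_pos.2 (h.sigma_pos hk)
  have h1 := norm_pos_iff.2 (h.vc_ne_zero hk hc)
  have h3 := (h.run.normal k hk).beta_ge hc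
  rw [h.norm_v_eq hk]
  have h4 : min (√(T.sigma k) * ‖T.vc k‖) p.theta
      = min 1 (p.theta / (‖T.vc k‖ * √(T.sigma k))) * (√(T.sigma k) * ‖T.vc k‖) := by
    rw [min_mul_of_nonneg _ _ (by positivity)]
    congr 1
    · ring
    · field_simp
  rw [h4]
  calc _ ≤ T.beta k * (√(T.sigma k) * ‖T.vc k‖) := by gcongr
    _ = _ := by ring

/-- Close to feasibility the full normal step is taken. -/
lemma beta_eq_one (hv : ‖T.vc k‖ ≤ p.zeta / √(T.sigma k)) : T.beta k = 1 := by
  refine le_antisymm (h.beta_le_one hk) ?_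
  by_cases hc : Q.c (T.x k) = 0
  · rw [((h.run.normal k hk).feasible hc).2]
  · have h2 := Real.sqrt_pos.2 (h.sigma_pos hk)
    have h1 := norm_pos_iff.2 (h.vc_ne_zero hk hc)
    refine (le_min le_rfl ?_).trans ((h.run.normal k hk).beta_ge hc)
    rw [le_div_iff₀ (by positivity), one_mul]
    rw [le_div_iff₀ h2] at hv
    exact hv.trans p.zeta_lt.le

lemma norm_v_le_norm_vc : ‖T.v k‖ ≤ ‖T.vc k‖ := by
  rw [h.norm_v_eq hk]
  exact mul_le_of_le_one_left (norm_nonneg _) (h.beta_le_one hk)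

lemma norm_v_le : ‖T.v k‖ ≤ 2 * K * (T.beta k * l1 (Q.c (T.x k))) := by
  rw [h.norm_v_eq hk]
  calc T.beta k * ‖T.vc k‖ ≤ T.beta k * (2 * K * l1 (Q.c (T.x k))) :=
        mul_le_mul_of_nonneg_left (h.norm_vc_le hk) (h.beta_pos hk).le
    _ = _ := by ring

lemma norm_vc_le_sq : ‖T.vc k‖ ≤ 2 * K ^ 2 := by
  have := h.K_pos
  calc ‖T.vc k‖ ≤ 2 * K * l1 (Q.c (T.x k)) := h.norm_vc_le hk
    _ ≤ 2 * K * K := by gcongr; exact h.bounds.c_le _ (h.x_mem hk)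
    _ = _ := by ring

lemma norm_v_le_sq : ‖T.v k‖ ≤ 2 * K ^ 2 := (h.norm_v_le_norm_vc hk).trans (h.norm_vc_le_sq hk)

lemma v_mem : T.v k ∈ (Q.A (T.x k)).adjoint.range := by
  rw [(h.run.normal k hk).v_eq]
  exact Submodule.smul_mem _ _ (h.run.normal k hk).vc_mem

lemma norm_lam_le : ‖T.lam k‖ ≤ K ^ 4 * (1 + 2 * p.rlam) := by
  have hx := h.x_mem hk
  have hK := h.K_pos
  have hr := p.rlam_nonneg
  have h1 := norm_le_sq_of_adjoint hK.le (h.bounds.adj _ hx) (T.lam k)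
  have h2 := h.run.multipliers k hk
  unfold Trace.Multipliers at h2
  rw [map_add] at h2
  have h3 : ‖Q.A (T.x k) (T.g Q k)‖ ≤ K * K :=
    (h.bounds.A_le _ hx _).trans (by gcongr; exact h.bounds.grad_le _ hx)
  have h4 := norm_sub_le (Q.A (T.x k) (T.g Q k) + Q.A (T.x k) (Q.AT (T.x k) (T.lam k)))
    (Q.A (T.x k) (T.g Q k))
  rw [add_sub_cancel_left] at h4
  have h5 : p.rlam * ‖T.v k‖ ≤ p.rlam * (2 * K ^ 2) := by gcongr; exact h.norm_v_le_sq hk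
  calc ‖T.lam k‖ ≤ K ^ 2 * ‖Q.A (T.x k) (Q.AT (T.x k) (T.lam k))‖ := h1
    _ ≤ K ^ 2 * (p.rlam * (2 * K ^ 2) + K * K) := by gcongr; linarith
    _ = _ := by ring

end Normal

end RegularRun

/-- A bound for the norm of the Hessians of the Lagrangian along a run. -/
noncomputable def Params.hessBound (p : Params) (K : ℝ) : ℝ := K * (1 + K ^ 4 * (1 + 2 * p.rlam))

lemma Params.one_le_hessBound (p : Params) {K : ℝ} (hK : 1 ≤ K) : 1 ≤ p.hessBound K := by
  have := p.rlam_nonneg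
  have : 0 ≤ K ^ 4 * (1 + 2 * p.rlam) := by positivity
  unfold Params.hessBound
  nlinarith

namespace RegularRun

variable {n m : ℕ} {p : Params} {Q : Problem n m} {T : Trace n m} {X : Set (Vec n)}
  {K epsg epsc epsH : ℝ} {k : ℕ}

section Tangential

variable (h : RegularRun p Q T X K epsg epsc epsH)

include h

lemma K_mul_le_hessBound (hk : T.Reached Q epsg epsc epsH k) :
    K * (1 + ‖T.lam k‖) ≤ p.hessBound K := by
  have h1 := h.K_pos
  unfold Params.hessBound
  gcongr
  exact h.norm_lam_le hk

lemma norm_lam_le_hessBound (hk : T.Reached Q epsg epsc epsH k) : ‖T.lam k‖ ≤ p.hessBound K := by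
  have h1 := h.bounds.one_le
  have h2 := h.K_mul_le_hessBound hk
  nlinarith [norm_nonneg (T.lam k)]

lemma norm_H_le (hk : T.Reached Q epsg epsc epsH k) (z : Vec n) :
    ‖T.H Q k z‖ ≤ p.hessBound K * ‖z‖ :=
  (h.bounds.H_le _ (h.x_mem hk) _ z).trans (by gcongr; exact h.K_mul_le_hessBound hk)

lemma H_symm (hk : T.Reached Q epsg epsc epsH k) (u w : Vec n) :
    inner ℝ (T.H Q k u) w = inner ℝ u (T.H Q k w) := h.bounds.H_symm _ (h.x_mem hk) _ u w

lemma norm_g_le (hk : T.Reached Q epsg epsc epsH k) : ‖T.g Q k‖ ≤ K :=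
  h.bounds.grad_le _ (h.x_mem hk)

omit h in
lemma P_symm (x u w : Vec n) : inner ℝ (Q.P x u) w = inner ℝ u (Q.P x w) :=
  Submodule.inner_starProjection_left_eq_right _ _ _

variable (hk : T.Reached Q epsg epsc epsH (k + 1))

include hk

lemma P_u : Q.P (T.x k) (T.u k) = T.u k := by
  have h1 := (h.run.oracle k hk).mem_range
  rw [Problem.P, Submodule.range_starProjection] at h1
  exact Submodule.starProjection_eq_self_iff.2 h1

lemma A_u : Q.A (T.x k) (T.u k) = 0 := by
  have h1 := (h.run.oracle k hk).mem_range
  rw [Problem.P, Submodule.range_starProjection] at h1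
  exact h1

lemma inner_v_u : inner ℝ (T.v k) (T.u k) = 0 :=
  inner_eq_zero_of_range_adjoint_of_ker (h.v_mem (hk.mono k.le_succ)) (h.A_u hk)

lemma gt_add_Ht_u : T.gt Q k + T.Ht Q k (T.u k) = Q.P (T.x k) (T.g Q k + T.H Q k (T.d k)) := by
  have h1 : T.Ht Q k (T.u k) = Q.P (T.x k) (T.H Q k (Q.P (T.x k) (T.u k))) := rfl
  rw [h1, h.P_u hk, Trace.gt, ← map_add, Trace.d, map_add (T.H Q k), add_assoc]

lemma Ht_symm (u w : Vec n) : inner ℝ (T.Ht Q k u) w = inner ℝ u (T.Ht Q k w) := by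
  change inner ℝ (Q.P (T.x k) (T.H Q k (Q.P (T.x k) u))) w
    = inner ℝ u (Q.P (T.x k) (T.H Q k (Q.P (T.x k) w)))
  rw [P_symm, h.H_symm (hk.mono k.le_succ), P_symm]

lemma gradient_mU :
    gradient (T.mU Q k) (T.u k) = Q.P (T.x k) (T.g Q k + T.H Q k (T.d k))
      + (T.sigma k * ‖T.u k‖) • T.u k := by
  refine HasGradientAt.gradient ?_
  rw [hasGradientAt_iff_hasFDerivAt]
  have h1 := (hasFDerivAt_const (T.gt Q k) (T.u k)).inner ℝ (hasFDerivAt_id (T.u k))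
  have h2 := ((hasFDerivAt_id (T.u k)).inner ℝ (T.Ht Q k).hasFDerivAt).const_mul (1 / 2 : ℝ)
  have h3 : HasFDerivAt (fun u => ‖Q.P (T.x k) u‖ ^ 3) _ (T.u k) :=
    ((hasFDerivAt_norm_rpow (Q.P (T.x k) (T.u k)) (p := 3) (by norm_num)).comp (T.u k)
      (Q.P (T.x k)).hasFDerivAt).congr_of_eventuallyEq (Filter.Eventually.of_forall fun u => by
        simp only [Function.comp]; norm_cast)
  have h4 := ((h1.const_add (Q.f (T.x k))).add h2).add (h3.const_mul (T.sigma k / 3))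
  refine h4.congr_fderiv ?_
  ext z
  rw [h.P_u hk, ← h.gt_add_Ht_u hk]
  have e1 : inner ℝ (T.u k) (Q.P (T.x k) z) = inner ℝ (T.u k) z := by
    rw [← P_symm, h.P_u hk]
  have e2 : inner ℝ z (T.Ht Q k (T.u k)) = inner ℝ (T.Ht Q k (T.u k)) z := real_inner_comm _ _
  have e3 : (‖T.u k‖ : ℝ) ^ ((3 : ℝ) - 2) = ‖T.u k‖ := by norm_num
  simp [fderivInnerCLM_apply, e1, e2, e3,
    ← h.Ht_symm hk]
  ring

/-- The projected gradient of the quadratic model at the trial step is of second order. -/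
lemma norm_projected_model_gradient_le :
    ‖Q.P (T.x k) (T.g Q k + T.H Q k (T.d k)) + (T.sigma k * ‖T.u k‖) • T.u k‖
      ≤ p.delta * T.sigma k * ‖T.u k‖ ^ 2 := by
  rw [← h.gradient_mU hk]
  exact (h.run.oracle k hk).grad

lemma neg_sigma_norm_u_le_inner (w : Vec n) :
    -(T.sigma k * ‖T.u k‖) * ‖w‖ ^ 2 ≤ inner ℝ w (T.Ht Q k w) :=
  (mul_le_mul_of_nonneg_right (h.run.oracle k hk).curvature (sq_nonneg _)).trans
    (minEig_mul_norm_sq_le (h.Ht_symm hk) w)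

lemma neg_sigma_norm_u_le_minEig :
    -(T.sigma k * ‖T.u k‖) ≤ minEig (Q.reducedHess (T.x k) (T.lam k)) := by
  have h0 := h.sigma_pos (hk.mono k.le_succ)
  refine le_minEig (neg_nonpos.2 (by positivity)) fun w => ?_
  have h1 := h.neg_sigma_norm_u_le_inner hk (w : Vec n)
  have h2 : Q.P (T.x k) (w : Vec n) = w := Submodule.starProjection_eq_self_iff.2 w.2
  have h3 : inner ℝ (w : Vec n) (T.Ht Q k w) = inner ℝ w (Q.reducedHess (T.x k) (T.lam k) w) := by
    change inner ℝ (w : Vec n) (Q.P (T.x k) (T.H Q k (Q.P (T.x k) w)))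
      = inner ℝ (w : Vec n) (Q.P (T.x k) (T.H Q k w))
    rw [h2]
  rw [← h3]
  exact h1

/-- The tangential step reduces its model at least by a multiple of `σ ‖u‖³`: the gradient
condition gives the first-order term and the curvature condition the second-order term. -/
lemma tangential_reduction_ge :
    (1 / 6 - p.delta) * (T.sigma k * ‖T.u k‖ ^ 3)
      ≤ -inner ℝ (T.g Q k + T.H Q k (T.v k)) (T.u k) - 1 / 2 * inner ℝ (T.u k) (T.H Q k (T.u k))
        - T.sigma k / 3 * ‖T.u k‖ ^ 3 := by
  have h0 := h.sigma_pos (hk.mono k.le_succ)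
  have h1 := (abs_real_inner_le_norm _ (T.u k)).trans
    (mul_le_mul_of_nonneg_right (h.norm_projected_model_gradient_le hk) (norm_nonneg (T.u k)))
  have h2 : inner ℝ (Q.P (T.x k) (T.g Q k + T.H Q k (T.d k)) + (T.sigma k * ‖T.u k‖) • T.u k)
      (T.u k) = inner ℝ (T.g Q k + T.H Q k (T.v k)) (T.u k) + inner ℝ (T.u k) (T.H Q k (T.u k))
        + T.sigma k * ‖T.u k‖ ^ 3 := by
    rw [inner_add_left, P_symm, h.P_u hk, real_inner_smul_left, real_inner_self_eq_norm_sq,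
      Trace.d, map_add, ← add_assoc, inner_add_left _ (T.H Q k (T.u k)),
      real_inner_comm (T.u k) (T.H Q k (T.u k))]
    ring
  rw [h2] at h1
  have h3 := h.neg_sigma_norm_u_le_inner hk (T.u k)
  have h4 : inner ℝ (T.u k) (T.Ht Q k (T.u k)) = inner ℝ (T.u k) (T.H Q k (T.u k)) := by
    change inner ℝ (T.u k) (Q.P (T.x k) (T.H Q k (Q.P (T.x k) (T.u k)))) = _
    rw [← P_symm, h.P_u hk]
  rw [h4] at h3
  have h5 := (abs_le.1 h1).2
  have e : p.delta * T.sigma k * ‖T.u k‖ ^ 2 * ‖T.u k‖ = p.delta * (T.sigma k * ‖T.u k‖ ^ 3) := by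
    ring
  have e' : -(T.sigma k * ‖T.u k‖) * ‖T.u k‖ ^ 2 = -(T.sigma k * ‖T.u k‖ ^ 3) := by ring
  rw [e] at h5
  rw [e'] at h3
  linarith

lemma norm_d_sq : ‖T.d k‖ ^ 2 = ‖T.v k‖ ^ 2 + ‖T.u k‖ ^ 2 := by
  rw [Trace.d, norm_add_sq_real, h.inner_v_u hk]; ring

lemma norm_v_le_norm_d : ‖T.v k‖ ≤ ‖T.d k‖ :=
  (sq_le_sq₀ (norm_nonneg _) (norm_nonneg _)).1
    (by rw [h.norm_d_sq hk]; nlinarith [sq_nonneg ‖T.u k‖])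

lemma norm_u_le_norm_d : ‖T.u k‖ ≤ ‖T.d k‖ :=
  (sq_le_sq₀ (norm_nonneg _) (norm_nonneg _)).1
    (by rw [h.norm_d_sq hk]; nlinarith [sq_nonneg ‖T.v k‖])

lemma A_d : Q.A (T.x k) (T.d k) = T.beta k • Q.A (T.x k) (T.vc k) := by
  rw [Trace.d, map_add, h.A_u hk, add_zero, (h.run.normal k (hk.mono k.le_succ)).v_eq, map_smul]

lemma linearized_l1_le :
    l1 (Q.c (T.x k) + Q.A (T.x k) (T.d k))
      ≤ (1 - T.beta k * (1 - p.rv)) * l1 (Q.c (T.x k)) := by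
  have hk' := hk.mono k.le_succ
  have e : Q.c (T.x k) + Q.A (T.x k) (T.d k) = (1 - T.beta k) • Q.c (T.x k)
      + T.beta k • (Q.A (T.x k) (T.vc k) + Q.c (T.x k)) := by
    rw [h.A_d hk, sub_smul, smul_add, one_smul]; abel
  have h1 := l1_add_le ((1 - T.beta k) • Q.c (T.x k))
    (T.beta k • (Q.A (T.x k) (T.vc k) + Q.c (T.x k)))
  rw [← e, l1_smul, l1_smul, abs_of_nonneg (sub_nonneg.2 (h.beta_le_one hk')),
    abs_of_pos (h.beta_pos hk')] at h1
  have h2 := mul_le_mul_of_nonneg_left (h.residual_le_l1 hk') (h.beta_pos hk').le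
  linarith

end Tangential

end RegularRun

/-! ### Model reduction and merit parameter -/

/-- A bound for `√σ ‖u‖` along a run. -/
noncomputable def Params.tangentialBound (p : Params) (K : ℝ) : ℝ :=
  3 * (K + p.hessBound K * (2 * K ^ 2)) + 3 / 2 * p.hessBound K / √p.sigmaMin + 1

lemma Params.one_le_tangentialBound (p : Params) {K : ℝ} (hK : 1 ≤ K) :
    1 ≤ p.tangentialBound K := by
  have hB := p.one_le_hessBound hK
  have hsm := Real.sqrt_pos.2 p.sigmaMin_pos
  have : 0 ≤ 3 * (K + p.hessBound K * (2 * K ^ 2)) + 3 / 2 * p.hessBound K / √p.sigmaMin := by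
    positivity
  unfold Params.tangentialBound
  linarith

/-- A bound for the numerator of the trial merit parameter in units of `‖v‖`. -/
noncomputable def Params.normalBound (p : Params) (K : ℝ) : ℝ :=
  K + p.hessBound K * K ^ 2 + (2 * p.tangentialBound K + 1) / 3

/-- A bound for the merit parameter along a run. -/
noncomputable def Params.meritBound (p : Params) (K : ℝ) : ℝ :=
  max p.muInit (p.nu * (2 * K * p.normalBound K / (1 - p.rv - p.tau)))

lemma cube_sub_cube_le {D U V : ℝ} (hU : 0 ≤ U) (hV : 0 ≤ V) (hD : 0 ≤ D)
    (h : D ^ 2 = V ^ 2 + U ^ 2) : D ^ 3 - U ^ 3 ≤ V ^ 2 * (2 * U + V) := by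
  have h1 : U ≤ D := by nlinarith
  have h2 : D ≤ V + U := by nlinarith [mul_nonneg hU hV]
  have h3 : D ^ 3 - U ^ 3 = V ^ 2 * (D + U) - U * D * (D - U) := by
    have : V ^ 2 = D ^ 2 - U ^ 2 := by linarith
    rw [this]; ring
  have h4 : 0 ≤ U * D * (D - U) := by
    have : 0 ≤ D - U := by linarith
    positivity
  have h5 : V ^ 2 * (D + U) ≤ V ^ 2 * (2 * U + V) :=
    mul_le_mul_of_nonneg_left (by linarith) (sq_nonneg V)
  linarith

namespace RegularRun

variable {n m : ℕ} {p : Params} {Q : Problem n m} {T : Trace n m} {X : Set (Vec n)}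
  {K epsg epsc epsH : ℝ} {k : ℕ}

lemma muInit_le_muPrev (h : RegularRun p Q T X K epsg epsc epsH) :
    ∀ k, T.Reached Q epsg epsc epsH k → p.muInit ≤ T.muPrev p k := by
  intro k
  induction k with
  | zero => intro _; exact le_rfl
  | succ k ih =>
    intro hk
    have h1 := ih (hk.mono k.le_succ)
    have h2 := h.run.merit k hk
    change p.muInit ≤ T.mu k
    rcases lt_or_ge (T.muPrev p k) (T.muC p Q k) with h3 | h3
    · rw [h2.increase h3]
      have := p.nu_gt
      have := p.muInit_pos
      nlinarith
    · rw [h2.keep h3]; exact h1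

variable (h : RegularRun p Q T X K epsg epsc epsH)

include h

lemma muPrev_le_mu (hk : T.Reached Q epsg epsc epsH (k + 1)) : T.muPrev p k ≤ T.mu k := by
  have h1 := h.muInit_le_muPrev k (hk.mono k.le_succ)
  have h2 := h.run.merit k hk
  rcases lt_or_ge (T.muPrev p k) (T.muC p Q k) with h3 | h3
  · rw [h2.increase h3]
    have := p.nu_gt
    have := p.muInit_pos
    nlinarith
  · rw [h2.keep h3]

lemma muC_le_mu (hk : T.Reached Q epsg epsc epsH (k + 1)) : T.muC p Q k ≤ T.mu k := by
  have h1 := h.muInit_le_muPrev k (hk.mono k.le_succ)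
  have h2 := h.run.merit k hk
  rcases lt_or_ge (T.muPrev p k) (T.muC p Q k) with h3 | h3
  · rw [h2.increase h3]
    have := p.nu_gt
    have := p.muInit_pos
    nlinarith
  · rw [h2.keep h3]; exact h3

lemma muInit_le_mu (hk : T.Reached Q epsg epsc epsH (k + 1)) : p.muInit ≤ T.mu k :=
  (h.muInit_le_muPrev k (hk.mono k.le_succ)).trans (h.muPrev_le_mu hk)

lemma mu_pos (hk : T.Reached Q epsg epsc epsH (k + 1)) : 0 < T.mu k :=
  p.muInit_pos.trans_le (h.muInit_le_mu hk)

lemma v_eq_zero (hk : T.Reached Q epsg epsc epsH k) (hc : Q.c (T.x k) = 0) : T.v k = 0 := by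
  rw [(h.run.normal k hk).v_eq, ((h.run.normal k hk).feasible hc).1, smul_zero]

lemma muC_mul_eq (hk : T.Reached Q epsg epsc epsH k) :
    inner ℝ (T.g Q k) (T.v k) + 1 / 2 * inner ℝ (T.v k) (T.H Q k (T.v k))
      + T.sigma k / 3 * (‖T.d k‖ ^ 3 - ‖T.u k‖ ^ 3)
      = (1 - p.rv - p.tau) * T.beta k * l1 (Q.c (T.x k)) * T.muC p Q k := by
  by_cases hc : l1 (Q.c (T.x k)) = 0
  · have hv := h.v_eq_zero hk (eq_zero_of_l1_eq_zero hc)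
    rw [Trace.d, hv, hc]
    simp
  · have h1 := h.beta_pos hk
    have h2 : 1 - p.rv - p.tau ≠ 0 := by have := p.rv_lt; intro h0; linarith
    rw [Trace.muC, if_neg hc]
    field_simp

omit h in
lemma redq_eq : T.redq Q k = -inner ℝ (T.g Q k) (T.d k)
    - 1 / 2 * inner ℝ (T.d k) (T.H Q k (T.d k)) - T.sigma k / 3 * ‖T.d k‖ ^ 3
    + T.mu k * (l1 (Q.c (T.x k)) - l1 (Q.c (T.x k) + Q.A (T.x k) (T.d k))) := by
  simp only [Trace.redq, Trace.q, inner_zero_right, norm_zero, map_zero, add_zero]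
  ring

lemma model_split (hk : T.Reached Q epsg epsc epsH k) :
    inner ℝ (T.g Q k) (T.d k) + 1 / 2 * inner ℝ (T.d k) (T.H Q k (T.d k))
      = inner ℝ (T.g Q k) (T.v k) + 1 / 2 * inner ℝ (T.v k) (T.H Q k (T.v k))
        + inner ℝ (T.g Q k + T.H Q k (T.v k)) (T.u k)
        + 1 / 2 * inner ℝ (T.u k) (T.H Q k (T.u k)) := by
  rw [Trace.d, map_add]
  simp only [inner_add_left, inner_add_right]
  rw [← h.H_symm hk (T.v k) (T.u k), real_inner_comm (T.H Q k (T.v k)) (T.u k)]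
  ring

/-- The predicted reduction bounds the tangential step and the constraint violation. -/
lemma redq_ge (hk : T.Reached Q epsg epsc epsH (k + 1)) :
    (1 / 6 - p.delta) * (T.sigma k * ‖T.u k‖ ^ 3)
      + p.tau * T.mu k * (T.beta k * l1 (Q.c (T.x k))) ≤ T.redq Q k := by
  have hk' := hk.mono k.le_succ
  have h1 := h.tangential_reduction_ge hk
  have h2 := h.model_split hk'
  have h3 := h.muC_mul_eq hk'
  have h4 := mul_le_mul_of_nonneg_left (h.linearized_l1_le hk) (h.mu_pos hk).le
  have h5 : (1 - p.rv - p.tau) * T.beta k * l1 (Q.c (T.x k)) * T.muC p Q k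
      ≤ (1 - p.rv - p.tau) * T.beta k * l1 (Q.c (T.x k)) * T.mu k := by
    refine mul_le_mul_of_nonneg_left (h.muC_le_mu hk) ?_
    have := p.rv_lt
    have : 0 ≤ 1 - p.rv - p.tau := by linarith
    have := (h.beta_pos hk').le
    have := l1_nonneg (Q.c (T.x k))
    positivity
  rw [redq_eq]
  nlinarith

lemma sqrt_sigma_mul_norm_u_le (hk : T.Reached Q epsg epsc epsH (k + 1)) :
    √(T.sigma k) * ‖T.u k‖ ≤ p.tangentialBound K := by
  have hk' := hk.mono k.le_succ
  have hs := h.sigma_pos hk'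
  have hK := h.K_pos
  have hB := p.one_le_hessBound h.bounds.one_le
  set B := p.hessBound K with hBdef
  have hsm := Real.sqrt_pos.2 p.sigmaMin_pos
  have hss : √p.sigmaMin ≤ √(T.sigma k) := Real.sqrt_le_sqrt (h.sigmaMin_le k hk')
  have hb : 0 ≤ 3 / 2 * B / √p.sigmaMin := by positivity
  have ha : 0 ≤ 3 * (K + B * (2 * K ^ 2)) := by positivity
  rw [Params.tangentialBound, ← hBdef]
  rcases le_or_gt (√(T.sigma k) * ‖T.u k‖) 1 with h1 | h1
  · linarith
  have hu : 0 < ‖T.u k‖ := by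
    rcases (norm_nonneg (T.u k)).eq_or_lt with h0 | h0
    · rw [← h0, mul_zero] at h1; linarith
    · exact h0
  have h2 := h.tangential_reduction_ge hk
  have h3 : 0 ≤ (1 / 6 - p.delta) * (T.sigma k * ‖T.u k‖ ^ 3) := by
    have := p.delta_lt
    have : 0 ≤ 1 / 6 - p.delta := by linarith
    positivity
  have h4 : |inner ℝ (T.g Q k + T.H Q k (T.v k)) (T.u k)| ≤ (K + B * (2 * K ^ 2)) * ‖T.u k‖ := by
    refine (abs_real_inner_le_norm _ _).trans ?_
    gcongr
    refine (norm_add_le _ _).trans (add_le_add (h.norm_g_le hk') ((h.norm_H_le hk' _).trans ?_))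
    gcongr
    exact h.norm_v_le_sq hk'
  have h5 : |inner ℝ (T.u k) (T.H Q k (T.u k))| ≤ ‖T.u k‖ * (B * ‖T.u k‖) := by
    refine (abs_real_inner_le_norm _ _).trans ?_
    gcongr
    exact h.norm_H_le hk' _
  have h6 : T.sigma k * ‖T.u k‖ ^ 2 ≤ 3 * (K + B * (2 * K ^ 2)) + 3 / 2 * B * ‖T.u k‖ := by
    have h7 := (abs_le.1 h4).1
    have h8 := (abs_le.1 h5).1
    refine le_of_mul_le_mul_right ?_ hu
    nlinarith
  have h7 : ‖T.u k‖ ≤ √(T.sigma k) * ‖T.u k‖ / √p.sigmaMin := by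
    rw [le_div_iff₀ hsm, mul_comm]
    gcongr
  have h8 : T.sigma k * ‖T.u k‖ ^ 2 = (√(T.sigma k) * ‖T.u k‖) ^ 2 := by
    rw [mul_pow, Real.sq_sqrt hs.le]
  rw [h8] at h6
  set t := √(T.sigma k) * ‖T.u k‖
  have h9 : t * t ≤ (3 * (K + B * (2 * K ^ 2)) + 3 / 2 * B / √p.sigmaMin) * t := by
    have e : 3 / 2 * B / √p.sigmaMin * t = 3 / 2 * B * (t / √p.sigmaMin) := by ring
    have : 3 / 2 * B * ‖T.u k‖ ≤ 3 / 2 * B * (t / √p.sigmaMin) := by gcongr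
    nlinarith
  have := le_of_mul_le_mul_right h9 (zero_lt_one.trans h1)
  linarith

lemma muC_le (hk : T.Reached Q epsg epsc epsH (k + 1)) :
    T.muC p Q k ≤ 2 * K * p.normalBound K / (1 - p.rv - p.tau) := by
  have hk' := hk.mono k.le_succ
  have hs := h.sigma_pos hk'
  have hK := h.K_pos
  have hB := p.one_le_hessBound h.bounds.one_le
  have hM := p.one_le_tangentialBound h.bounds.one_le
  have hr : 0 < 1 - p.rv - p.tau := by have := p.rv_lt; linarith
  have hN : 0 ≤ p.normalBound K := by unfold Params.normalBound; positivity
  by_cases hc : l1 (Q.c (T.x k)) = 0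
  · rw [Trace.muC, if_pos hc]; positivity
  have hl : 0 < l1 (Q.c (T.x k)) := lt_of_le_of_ne (l1_nonneg _) (Ne.symm hc)
  have hb := h.beta_pos hk'
  have h0 := h.muC_mul_eq hk'
  have h1 : inner ℝ (T.g Q k) (T.v k) ≤ K * ‖T.v k‖ :=
    (real_inner_le_norm _ _).trans (by gcongr; exact h.norm_g_le hk')
  have h2 : inner ℝ (T.v k) (T.H Q k (T.v k)) ≤ 2 * (p.hessBound K * K ^ 2) * ‖T.v k‖ := by
    calc _ ≤ ‖T.v k‖ * ‖T.H Q k (T.v k)‖ := real_inner_le_norm _ _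
      _ ≤ ‖T.v k‖ * (p.hessBound K * (2 * K ^ 2)) := by
        gcongr
        exact (h.norm_H_le hk' _).trans (by gcongr; exact h.norm_v_le_sq hk')
      _ = _ := by ring
  have h3 : T.sigma k * (‖T.d k‖ ^ 3 - ‖T.u k‖ ^ 3)
      ≤ (2 * p.tangentialBound K + 1) * ‖T.v k‖ := by
    have ev := h.sqrt_sigma_mul_norm_v_le hk'
    have eu := h.sqrt_sigma_mul_norm_u_le hk
    calc _ ≤ T.sigma k * (‖T.v k‖ ^ 2 * (2 * ‖T.u k‖ + ‖T.v k‖)) := by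
          gcongr
          exact cube_sub_cube_le (norm_nonneg _) (norm_nonneg _) (norm_nonneg _) (h.norm_d_sq hk)
      _ = √(T.sigma k) ^ 2 * (‖T.v k‖ ^ 2 * (2 * ‖T.u k‖ + ‖T.v k‖)) := by
          rw [Real.sq_sqrt hs.le]
      _ = (√(T.sigma k) * ‖T.v k‖) * (2 * (√(T.sigma k) * ‖T.u k‖) + √(T.sigma k) * ‖T.v k‖)
          * ‖T.v k‖ := by ring
      _ ≤ 1 * (2 * p.tangentialBound K + 1) * ‖T.v k‖ := by gcongr
      _ = _ := by ring
  have h4 : (1 - p.rv - p.tau) * T.beta k * l1 (Q.c (T.x k)) * T.muC p Q k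
      ≤ p.normalBound K * ‖T.v k‖ := by
    rw [← h0, Params.normalBound]
    linarith
  have h5 : p.normalBound K * ‖T.v k‖
      ≤ p.normalBound K * (2 * K * (T.beta k * l1 (Q.c (T.x k)))) := by
    gcongr
    exact h.norm_v_le hk'
  rw [le_div_iff₀ hr]
  refine le_of_mul_le_mul_right ?_ (mul_pos hb hl)
  linarith

lemma muPrev_le_meritBound :
    ∀ k, T.Reached Q epsg epsc epsH k → T.muPrev p k ≤ p.meritBound K := by
  intro k
  induction k with
  | zero => intro _; exact le_max_left _ _
  | succ k ih =>
    intro hk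
    have h1 := ih (hk.mono k.le_succ)
    have h2 := h.run.merit k hk
    change T.mu k ≤ _
    rcases lt_or_ge (T.muPrev p k) (T.muC p Q k) with h3 | h3
    · rw [h2.increase h3]
      refine le_trans ?_ (le_max_right _ _)
      exact mul_le_mul_of_nonneg_left (h.muC_le hk) (zero_lt_one.trans p.nu_gt).le
    · rw [h2.keep h3]; exact h1

lemma mu_le_meritBound (hk : T.Reached Q epsg epsc epsH (k + 1)) : T.mu k ≤ p.meritBound K :=
  h.muPrev_le_meritBound (k + 1) hk

lemma redq_nonneg (hk : T.Reached Q epsg epsc epsH (k + 1)) : 0 ≤ T.redq Q k := by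
  have h1 := h.redq_ge hk
  have h2 := h.beta_pos (hk.mono k.le_succ)
  have h3 := h.sigma_pos (hk.mono k.le_succ)
  have h4 := l1_nonneg (Q.c (T.x k))
  have h5 : 0 ≤ 1 / 6 - p.delta := by have := p.delta_lt; linarith
  have h6 := p.tau_pos
  have h7 := h.mu_pos hk
  exact le_trans (by positivity) h1

omit h in
lemma P_adjoint (x : Vec n) (y : Vec m) : Q.P x ((Q.A x).adjoint y) = 0 := by
  refine (Submodule.starProjection_apply_eq_zero_iff _).2 ((Submodule.mem_orthogonal' _ _).2 ?_)
  exact fun u hu => inner_eq_zero_of_range_adjoint_of_ker ⟨y, rfl⟩ hu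

/-- If the model predicts no reduction then the iterate is stationary. -/
lemma redq_pos (hg : 0 ≤ epsg) (hc : 0 ≤ epsc) (hH : 0 ≤ epsH)
    (hk : T.Reached Q epsg epsc epsH (k + 1)) : 0 < T.redq Q k := by
  have hk' := hk.mono k.le_succ
  refine lt_of_le_of_ne (h.redq_nonneg hk) fun h0 => hk k (Nat.lt_succ_self k) ?_
  have h1 := h.redq_ge hk
  rw [← h0] at h1
  have h2 := h.beta_pos hk'
  have h3 := h.sigma_pos hk'
  have h4 := l1_nonneg (Q.c (T.x k))
  have h5 : 0 < 1 / 6 - p.delta := by have := p.delta_lt; linarith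
  have h6 := p.tau_pos
  have h7 := h.mu_pos hk
  have ht : 0 ≤ (1 / 6 - p.delta) * (T.sigma k * ‖T.u k‖ ^ 3) := by positivity
  have hn : 0 ≤ p.tau * T.mu k * (T.beta k * l1 (Q.c (T.x k))) := by positivity
  have hu : T.u k = 0 := by
    by_contra hu
    have := norm_pos_iff.2 hu
    have : 0 < (1 / 6 - p.delta) * (T.sigma k * ‖T.u k‖ ^ 3) := by positivity
    linarith
  have hc0 : Q.c (T.x k) = 0 := by
    by_contra hc0
    have := l1_pos hc0
    have : 0 < p.tau * T.mu k * (T.beta k * l1 (Q.c (T.x k))) := by positivity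
    linarith
  have hv := h.v_eq_zero hk' hc0
  refine ⟨?_, ?_, ?_⟩
  · rw [h.bounds.gradLag_eq _ (h.x_mem hk')]
    have hm := h.run.multipliers k hk'
    rw [Trace.Multipliers, hv, norm_zero, mul_zero] at hm
    have hA := norm_le_zero_iff.1 hm
    have hP := h.norm_projected_model_gradient_le hk
    rw [Trace.d, hv, hu] at hP
    simp only [add_zero, map_zero, norm_zero, mul_zero, smul_zero, ne_eq, OfNat.ofNat_ne_zero,
      not_false_eq_true, zero_pow, norm_le_zero_iff] at hP
    have hz : Q.P (T.x k) (T.g Q k + Q.AT (T.x k) (T.lam k))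
        = T.g Q k + Q.AT (T.x k) (T.lam k) := Submodule.starProjection_eq_self_iff.2 hA
    rw [map_add, hP, zero_add] at hz
    change ‖T.g Q k + Q.AT (T.x k) (T.lam k)‖ ≤ epsg
    rw [← hz, Problem.AT, P_adjoint, norm_zero]
    exact hg
  · rw [hc0, l1_zero]; exact hc
  · have := h.neg_sigma_norm_u_le_minEig hk
    rw [hu, norm_zero, mul_zero, neg_zero] at this
    linarith

end RegularRun

/-! ### Acceptance of steps for large regularization parameters -/

/-- A bound for the norm of the trial steps along a run. -/
noncomputable def Params.trialBound (p : Params) (K : ℝ) : ℝ :=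
  (p.tangentialBound K + 1) / √p.sigmaMin

/-- A bound for the norm of the correction steps in units of `‖d‖²`. -/
noncomputable def Params.corrBound (p : Params) (K : ℝ) : ℝ :=
  K * (p.rw * p.trialBound K + (p.trialBound K + K))

lemma Params.meritBound_pos (p : Params) (K : ℝ) : 0 < p.meritBound K :=
  p.muInit_pos.trans_le (le_max_left _ _)

lemma Params.trialBound_pos (p : Params) {K : ℝ} (hK : 1 ≤ K) : 0 < p.trialBound K := by
  have := p.one_le_tangentialBound hK
  have hsm := Real.sqrt_pos.2 p.sigmaMin_pos
  unfold Params.trialBound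
  positivity

lemma Params.corrBound_pos (p : Params) {K : ℝ} (hK : 1 ≤ K) : 0 < p.corrBound K := by
  have := p.trialBound_pos hK
  have := p.rw_nonneg
  unfold Params.corrBound
  positivity

/-- The error of the model at the trial step is at most this multiple of `‖d‖²`. -/
noncomputable def Params.trialError (p : Params) (K : ℝ) : ℝ :=
  K + 1 / 2 * p.hessBound K + p.meritBound K * K

/-- After a correction step the constraint violation is at most this multiple of `‖d‖³`. -/
noncomputable def Params.corrViolation (p : Params) (m : ℕ) (K : ℝ) : ℝ :=
  K * (p.corrBound K ^ 2 * p.trialBound K) + m * (K * p.corrBound K) + m * p.rw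

/-- The error of the quadratic model at the corrected step is at most this multiple of `‖d‖³`. -/
noncomputable def Params.corrError (p : Params) (m : ℕ) (K : ℝ) : ℝ :=
  2 * p.hessBound K + p.hessBound K * p.rw + p.rlam * K * p.corrBound K
    + K * p.corrBound K + K * (p.corrBound K ^ 2 * p.trialBound K)
    + p.meritBound K * p.corrViolation m K

/-- A threshold from which on the regularization parameter guarantees success. -/
noncomputable def Params.sigmaThreshold (p : Params) (m : ℕ) (K : ℝ) : ℝ :=
  max (3 * p.corrError m K)
    ((p.trialError K * (p.tangentialBound K + 1) ^ 2 * (2 * K)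
      / ((1 - p.eta1) * (p.tau * p.muInit * p.zeta))) ^ 2)

namespace RegularRun

variable {n m : ℕ} {p : Params} {Q : Problem n m} {T : Trace n m} {X : Set (Vec n)}
  {K epsg epsc epsH : ℝ} {k : ℕ} (h : RegularRun p Q T X K epsg epsc epsH)

include h

lemma trialError_pos : 0 < p.trialError K := by
  have := p.meritBound_pos K
  have := h.K_pos
  have := p.one_le_hessBound h.bounds.one_le
  unfold Params.trialError
  positivity

section Trial

variable (hk : T.Reached Q epsg epsc epsH (k + 1))

include hk

lemma sqrt_sigma_mul_norm_d_le : √(T.sigma k) * ‖T.d k‖ ≤ p.tangentialBound K + 1 := by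
  have h1 := h.sqrt_sigma_mul_norm_u_le hk
  have h2 := h.sqrt_sigma_mul_norm_v_le (hk.mono k.le_succ)
  have h3 : √(T.sigma k) * ‖T.d k‖ ≤ √(T.sigma k) * (‖T.v k‖ + ‖T.u k‖) := by
    gcongr; exact norm_add_le _ _
  linarith

lemma norm_d_le : ‖T.d k‖ ≤ p.trialBound K := by
  have h1 := h.sqrt_sigma_mul_norm_d_le hk
  have hsm := Real.sqrt_pos.2 p.sigmaMin_pos
  have hss := Real.sqrt_le_sqrt (h.sigmaMin_le k (hk.mono k.le_succ))
  rw [Params.trialBound, le_div_iff₀ hsm, mul_comm]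
  exact (mul_le_mul_of_nonneg_right hss (norm_nonneg _)).trans h1

/-- The trial step decreases the merit function as predicted, up to a second-order error. -/
lemma merit_sub_trial_ge :
    T.redq Q k - p.trialError K * ‖T.d k‖ ^ 2
      ≤ Q.merit (T.x k) (T.mu k) - Q.merit (T.x k + T.d k) (T.mu k) := by
  have hk' := hk.mono k.le_succ
  have hx := h.x_mem hk'
  have hy := h.stays.trial k hk
  have hf := (abs_le.1 (h.bounds.f_taylor _ hx _ hy)).2
  have hc := h.bounds.c_taylor _ hx _ hy
  rw [add_sub_cancel_left] at hf hc
  have hH : |inner ℝ (T.d k) (T.H Q k (T.d k))| ≤ ‖T.d k‖ * (p.hessBound K * ‖T.d k‖) :=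
    (abs_real_inner_le_norm _ _).trans (by gcongr; exact h.norm_H_le hk' _)
  have hH1 := (abs_le.1 hH).1
  have hc1 := l1_add_le (Q.c (T.x k + T.d k) - Q.c (T.x k) - Q.A (T.x k) (T.d k))
    (Q.c (T.x k) + Q.A (T.x k) (T.d k))
  rw [sub_sub, sub_add_cancel] at hc1
  rw [sub_sub] at hc
  have hmu : T.mu k * (l1 (Q.c (T.x k + T.d k)) - l1 (Q.c (T.x k) + Q.A (T.x k) (T.d k)))
      ≤ p.meritBound K * K * ‖T.d k‖ ^ 2 := by
    calc _ ≤ T.mu k * (K * ‖T.d k‖ ^ 2) :=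
          mul_le_mul_of_nonneg_left (by linarith) (h.mu_pos hk).le
      _ ≤ p.meritBound K * (K * ‖T.d k‖ ^ 2) :=
          mul_le_mul_of_nonneg_right (h.mu_le_meritBound hk)
            (mul_nonneg h.K_pos.le (sq_nonneg _))
      _ = _ := by ring
  have hs := h.sigma_pos hk'
  have hcube : 0 ≤ T.sigma k / 3 * ‖T.d k‖ ^ 3 := by positivity
  rw [redq_eq, Problem.merit, Problem.merit, Params.trialError]
  rw [show gradient Q.f (T.x k) = T.g Q k from rfl] at hf
  nlinarith

end Trial

section Corrected

variable (hk : T.Reached Q epsg epsc epsH (k + 1)) (hcor : T.Corrects p Q k)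

include hk hcor

lemma norm_vc_le_norm_d : ‖T.vc k‖ ≤ ‖T.d k‖ := by
  have hk' := hk.mono k.le_succ
  have h1 := h.norm_v_eq hk'
  rw [h.beta_eq_one hk' hcor.2, one_mul] at h1
  rw [← h1]
  exact h.norm_v_le_norm_d hk

lemma linearized_l1_le_cube : l1 (Q.c (T.x k) + Q.A (T.x k) (T.d k)) ≤ ‖T.d k‖ ^ 3 := by
  have hk' := hk.mono k.le_succ
  rw [h.A_d hk, h.beta_eq_one hk' hcor.2, one_smul, add_comm]
  have h1 : p.rv ≤ 1 := by have := p.rv_lt; have := p.tau_pos; linarith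
  calc _ ≤ p.rv * ‖T.vc k‖ ^ 3 := h.residual_le_cube hk'
    _ ≤ 1 * ‖T.d k‖ ^ 3 := by gcongr; exact h.norm_vc_le_norm_d hk hcor
    _ = _ := one_mul _

omit hcor in
lemma cube_le : ‖T.d k‖ ^ 3 ≤ p.trialBound K * ‖T.d k‖ ^ 2 := by
  calc ‖T.d k‖ ^ 3 = ‖T.d k‖ * ‖T.d k‖ ^ 2 := by ring
    _ ≤ _ := by gcongr; exact h.norm_d_le hk

lemma l1_c_trial_le : l1 (Q.c (T.x k + T.d k)) ≤ (p.trialBound K + K) * ‖T.d k‖ ^ 2 := by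
  have hc := h.bounds.c_taylor _ (h.x_mem (hk.mono k.le_succ)) _ (h.stays.trial k hk)
  rw [add_sub_cancel_left, sub_sub] at hc
  have hc1 := l1_add_le (Q.c (T.x k + T.d k) - (Q.c (T.x k) + Q.A (T.x k) (T.d k)))
    (Q.c (T.x k) + Q.A (T.x k) (T.d k))
  rw [sub_add_cancel] at hc1
  have h1 := h.linearized_l1_le_cube hk hcor
  have h2 := h.cube_le hk
  linarith

lemma norm_w_le : ‖T.w k‖ ≤ p.corrBound K * ‖T.d k‖ ^ 2 := by
  have hx := h.x_mem (hk.mono k.le_succ)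
  have hw := h.run.correction k hk hcor
  have h1 := norm_le_of_mem_range_adjoint (h.bounds.adj _ hx) hw.mem_range
  have h2 := norm_sub_le (Q.A (T.x k) (T.w k) + Q.c (T.x k + T.d k)) (Q.c (T.x k + T.d k))
  rw [add_sub_cancel_right] at h2
  have h3 := (norm_le_l1 _).trans (h.l1_c_trial_le hk hcor)
  have h4 := hw.residual.trans (mul_le_mul_of_nonneg_left (h.cube_le hk) p.rw_nonneg)
  have h5 := h.K_pos
  calc ‖T.w k‖ ≤ K * ‖Q.A (T.x k) (T.w k)‖ := h1
    _ ≤ K * (p.rw * (p.trialBound K * ‖T.d k‖ ^ 2) + (p.trialBound K + K) * ‖T.d k‖ ^ 2) := by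
      gcongr; linarith
    _ = _ := by rw [Params.corrBound]; ring

lemma norm_w_sq_le : ‖T.w k‖ ^ 2 ≤ p.corrBound K ^ 2 * p.trialBound K * ‖T.d k‖ ^ 3 := by
  have h1 := h.norm_w_le hk hcor
  have h2 := h.norm_d_le hk
  calc ‖T.w k‖ ^ 2 ≤ (p.corrBound K * ‖T.d k‖ ^ 2) ^ 2 := by gcongr
    _ = p.corrBound K ^ 2 * ‖T.d k‖ * ‖T.d k‖ ^ 3 := by ring
    _ ≤ _ := by gcongr

lemma norm_d_mul_norm_w_le : ‖T.d k‖ * ‖T.w k‖ ≤ p.corrBound K * ‖T.d k‖ ^ 3 := by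
  calc ‖T.d k‖ * ‖T.w k‖ ≤ ‖T.d k‖ * (p.corrBound K * ‖T.d k‖ ^ 2) := by
        gcongr; exact h.norm_w_le hk hcor
    _ = _ := by ring

lemma l1_c_corrected_le :
    l1 (Q.c (T.x k + T.d k + T.w k)) ≤ p.corrViolation m K * ‖T.d k‖ ^ 3 := by
  have hx := h.x_mem (hk.mono k.le_succ)
  have hy := h.stays.trial k hk
  have hz := h.stays.corrected k hk hcor
  have hw := h.run.correction k hk hcor
  have hK := h.K_pos
  have hc := h.bounds.c_taylor _ hy _ hz
  rw [add_sub_cancel_left] at hc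
  have hA := h.bounds.A_lip _ hx _ hy (T.w k)
  rw [add_sub_cancel_left] at hA
  have e : Q.c (T.x k + T.d k + T.w k)
      = (Q.c (T.x k + T.d k + T.w k) - Q.c (T.x k + T.d k) - Q.A (T.x k + T.d k) (T.w k))
        + (Q.A (T.x k + T.d k) (T.w k) - Q.A (T.x k) (T.w k))
        + (Q.A (T.x k) (T.w k) + Q.c (T.x k + T.d k)) := by abel
  have h1 := l1_le_card_mul_norm (Q.A (T.x k + T.d k) (T.w k) - Q.A (T.x k) (T.w k))
  have h2 := l1_le_card_mul_norm (Q.A (T.x k) (T.w k) + Q.c (T.x k + T.d k))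
  have h3 : (m : ℝ) * ‖Q.A (T.x k + T.d k) (T.w k) - Q.A (T.x k) (T.w k)‖
      ≤ m * (K * p.corrBound K) * ‖T.d k‖ ^ 3 := by
    calc _ ≤ (m : ℝ) * (K * (‖T.d k‖ * ‖T.w k‖)) := by rw [← mul_assoc K]; gcongr
      _ ≤ (m : ℝ) * (K * (p.corrBound K * ‖T.d k‖ ^ 3)) := by
        exact mul_le_mul_of_nonneg_left (mul_le_mul_of_nonneg_left
          (h.norm_d_mul_norm_w_le hk hcor) hK.le) (Nat.cast_nonneg m)
      _ = _ := by ring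
  have h4 := mul_le_mul_of_nonneg_left hw.residual (Nat.cast_nonneg (α := ℝ) m)
  have h5 := mul_le_mul_of_nonneg_left (h.norm_w_sq_le hk hcor) hK.le
  rw [e]
  refine (l1_add_le _ _).trans ((add_le_add_left (l1_add_le _ _) _).trans ?_)
  rw [Params.corrViolation]
  linarith

/-- The slope of the objective along the correction step, up to a third-order error: the
multipliers turn it into the value of the constraints at the trial point. -/
lemma inner_g_w_le :
    inner ℝ (T.g Q k) (T.w k) ≤ inner ℝ (T.lam k) (Q.c (T.x k + T.d k))
      + (p.hessBound K * p.rw + p.rlam * K * p.corrBound K) * ‖T.d k‖ ^ 3 := by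
  have hk' := hk.mono k.le_succ
  have hx := h.x_mem hk'
  have hw := h.run.correction k hk hcor
  have hK := h.K_pos
  have hr := p.rlam_nonneg
  obtain ⟨y, hy⟩ := hw.mem_range
  change (Q.A (T.x k)).adjoint y = T.w k at hy
  have h1 : inner ℝ (T.g Q k) (T.w k)
      = inner ℝ (Q.A (T.x k) (T.g Q k + Q.AT (T.x k) (T.lam k))) y
        - inner ℝ (T.lam k) (Q.A (T.x k) (T.w k)) := by
    rw [← ContinuousLinearMap.adjoint_inner_right, hy, inner_add_left, Problem.AT,
      ContinuousLinearMap.adjoint_inner_left]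
    ring
  have h2 : inner ℝ (Q.A (T.x k) (T.g Q k + Q.AT (T.x k) (T.lam k))) y
      ≤ p.rlam * K * p.corrBound K * ‖T.d k‖ ^ 3 := by
    calc _ ≤ ‖Q.A (T.x k) (T.g Q k + Q.AT (T.x k) (T.lam k))‖ * ‖y‖ := real_inner_le_norm _ _
      _ ≤ (p.rlam * ‖T.d k‖) * (K * ‖T.w k‖) := by
        gcongr
        · exact (h.run.multipliers k hk').trans (by gcongr; exact h.norm_v_le_norm_d hk)
        · rw [← hy]; exact h.bounds.adj _ hx y
      _ = p.rlam * K * (‖T.d k‖ * ‖T.w k‖) := by ring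
      _ ≤ p.rlam * K * (p.corrBound K * ‖T.d k‖ ^ 3) := by
        exact mul_le_mul_of_nonneg_left (h.norm_d_mul_norm_w_le hk hcor)
          (mul_nonneg hr hK.le)
      _ = _ := by ring
  have h3 : |inner ℝ (T.lam k) (Q.A (T.x k) (T.w k) + Q.c (T.x k + T.d k))|
      ≤ p.hessBound K * (p.rw * ‖T.d k‖ ^ 3) := by
    have := p.one_le_hessBound h.bounds.one_le
    refine (abs_real_inner_le_norm _ _).trans ?_
    gcongr
    · exact h.norm_lam_le_hessBound hk'
    · exact hw.residual
  rw [inner_add_right] at h3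
  have h4 := (abs_le.1 h3).1
  rw [h1]
  linarith

/-- The corrected step decreases the merit function as predicted, up to a third-order error that
the regularization term absorbs. -/
lemma merit_sub_corrected_ge :
    T.redq Q k + (T.sigma k / 3 - p.corrError m K) * ‖T.d k‖ ^ 3
      ≤ Q.merit (T.x k) (T.mu k) - Q.merit (T.x k + T.d k + T.w k) (T.mu k) := by
  have hk' := hk.mono k.le_succ
  have hx := h.x_mem hk'
  have hy := h.stays.trial k hk
  have hz := h.stays.corrected k hk hcor
  have hK := h.K_pos
  have hB := p.one_le_hessBound h.bounds.one_le
  have e1 := (abs_le.1 (h.bounds.f_taylor _ hy _ hz)).2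
  rw [add_sub_cancel_left] at e1
  have e2 := mul_le_mul_of_nonneg_left (h.norm_w_sq_le hk hcor) hK.le
  have e3 : inner ℝ (gradient Q.f (T.x k + T.d k)) (T.w k)
      ≤ inner ℝ (T.g Q k) (T.w k) + K * p.corrBound K * ‖T.d k‖ ^ 3 := by
    have h1 := h.bounds.grad_lip _ hx _ hy
    rw [add_sub_cancel_left] at h1
    have h2 := real_inner_le_norm (gradient Q.f (T.x k + T.d k) - gradient Q.f (T.x k)) (T.w k)
    rw [inner_sub_left] at h2
    have h3 := mul_le_mul_of_nonneg_right h1 (norm_nonneg (T.w k))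
    have h4 := mul_le_mul_of_nonneg_left (h.norm_d_mul_norm_w_le hk hcor) hK.le
    have h5 : T.g Q k = gradient Q.f (T.x k) := rfl
    rw [h5]
    linarith
  have e4 := h.inner_g_w_le hk hcor
  have e5 := (abs_le.1 (h.bounds.lag_taylor _ hx _ hy (T.lam k))).2
  rw [add_sub_cancel_left, show gradient Q.f (T.x k) = T.g Q k from rfl,
    show Q.H (T.x k) (T.lam k) = T.H Q k from rfl, sub_sub (Q.c _), inner_sub_right] at e5
  have e6 := mul_le_mul_of_nonneg_right (h.K_mul_le_hessBound hk')
    (pow_nonneg (norm_nonneg (T.d k)) 3)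
  have e7 : inner ℝ (T.lam k) (Q.c (T.x k) + Q.A (T.x k) (T.d k))
      ≤ p.hessBound K * ‖T.d k‖ ^ 3 := by
    refine (le_abs_self _).trans ((abs_inner_le_l1 _ _).trans ?_)
    gcongr
    · exact l1_nonneg _
    · exact h.norm_lam_le_hessBound hk'
    · exact h.linearized_l1_le_cube hk hcor
  have e8 : T.mu k * l1 (Q.c (T.x k + T.d k + T.w k))
      ≤ p.meritBound K * p.corrViolation m K * ‖T.d k‖ ^ 3 := by
    calc _ ≤ p.meritBound K * (p.corrViolation m K * ‖T.d k‖ ^ 3) := by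
          have := p.meritBound_pos K
          gcongr
          · exact l1_nonneg _
          · exact h.mu_le_meritBound hk
          · exact h.l1_c_corrected_le hk hcor
      _ = _ := by ring
  have e9 := mul_nonneg (h.mu_pos hk).le (l1_nonneg (Q.c (T.x k) + Q.A (T.x k) (T.d k)))
  rw [redq_eq, Problem.merit, Problem.merit, Params.corrError]
  linarith

end Corrected

/-- The regularization parameter can only be increased while it is below the threshold. -/
lemma successful_of_sigmaThreshold_le (hg : 0 ≤ epsg) (hc : 0 ≤ epsc) (hH : 0 ≤ epsH)
    (hk : T.Reached Q epsg epsc epsH (k + 1)) (hs : p.sigmaThreshold m K ≤ T.sigma k) :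
    T.Successful p Q k := by
  have hk' := hk.mono k.le_succ
  have hq := h.redq_pos hg hc hH hk
  have heta : p.eta1 < 1 := p.eta1_lt.trans p.eta2_lt
  have hsig := h.sigma_pos hk'
  have hsq := Real.sqrt_pos.2 hsig
  by_contra hS
  have hrho : T.rho Q k < p.eta1 := by
    by_contra h0
    exact hS (Or.inl (not_lt.1 h0))
  rcases le_or_gt ‖T.vc k‖ (p.zeta / √(T.sigma k)) with hv | hv
  · have hcor : T.Corrects p Q k := ⟨hrho, hv⟩
    refine hS (Or.inr ⟨hcor, heta.le.trans ?_⟩)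
    rw [Trace.rhoCorr, le_div_iff₀ hq, one_mul]
    refine le_trans ?_ (h.merit_sub_corrected_ge hk hcor)
    have h1 : 0 ≤ T.sigma k / 3 - p.corrError m K := by
      have := (le_max_left _ _).trans hs
      linarith
    have : 0 ≤ (T.sigma k / 3 - p.corrError m K) * ‖T.d k‖ ^ 3 := by positivity
    linarith
  · refine absurd hrho (not_lt.2 ?_)
    have hz := p.zeta_pos
    have ht := p.tau_pos
    have hmu := p.muInit_pos
    have hK := h.K_pos
    have hE := h.trialError_pos
    have he : 0 < 1 - p.eta1 := by linarith
    have hcne : Q.c (T.x k) ≠ 0 := by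
      intro h0
      rw [((h.run.normal k hk').feasible h0).1, norm_zero] at hv
      exact absurd hv (not_lt.2 (by positivity))
    -- far from feasibility the normal step alone contributes a multiple of `1 / √σ`
    have hvz : p.zeta ≤ √(T.sigma k) * ‖T.v k‖ := by
      refine le_trans (le_min ?_ p.zeta_lt.le) (h.min_le_sqrt_sigma_mul_norm_v hk' hcne)
      rw [div_lt_iff₀ hsq] at hv
      linarith
    have hred : p.tau * p.muInit * p.zeta ≤ √(T.sigma k) * (2 * K) * T.redq Q k := by
      have h1 := h.redq_ge hk
      have h2 : 0 ≤ (1 / 6 - p.delta) * (T.sigma k * ‖T.u k‖ ^ 3) := by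
        have := p.delta_lt
        have : 0 ≤ 1 / 6 - p.delta := by linarith
        positivity
      have h3 := h.norm_v_le hk'
      have hbl : 0 ≤ T.beta k * l1 (Q.c (T.x k)) :=
        mul_nonneg (h.beta_pos hk').le (l1_nonneg _)
      calc p.tau * p.muInit * p.zeta
          ≤ p.tau * p.muInit * (√(T.sigma k) * (2 * K * (T.beta k * l1 (Q.c (T.x k))))) := by
            gcongr
            exact hvz.trans (by gcongr)
        _ ≤ p.tau * T.mu k * (√(T.sigma k) * (2 * K * (T.beta k * l1 (Q.c (T.x k))))) := by
            gcongr
            exact h.muInit_le_mu hk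
        _ = √(T.sigma k) * (2 * K) * (p.tau * T.mu k * (T.beta k * l1 (Q.c (T.x k)))) := by ring
        _ ≤ _ := by gcongr; linarith
    have hR := (le_max_right _ _).trans hs
    rw [← Real.le_sqrt' (by have := p.one_le_tangentialBound h.bounds.one_le; positivity),
      div_le_iff₀ (by positivity)] at hR
    have hd : T.sigma k * ‖T.d k‖ ^ 2 ≤ (p.tangentialBound K + 1) ^ 2 := by
      have h1 := h.sqrt_sigma_mul_norm_d_le hk
      calc T.sigma k * ‖T.d k‖ ^ 2 = (√(T.sigma k) * ‖T.d k‖) ^ 2 := by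
            rw [mul_pow, Real.sq_sqrt hsig.le]
        _ ≤ _ := by gcongr
    have hfin : p.trialError K * ‖T.d k‖ ^ 2 ≤ (1 - p.eta1) * T.redq Q k := by
      refine le_of_mul_le_mul_left ?_ (by positivity : 0 < T.sigma k * (2 * K))
      calc T.sigma k * (2 * K) * (p.trialError K * ‖T.d k‖ ^ 2)
          = p.trialError K * (T.sigma k * ‖T.d k‖ ^ 2) * (2 * K) := by ring
        _ ≤ p.trialError K * (p.tangentialBound K + 1) ^ 2 * (2 * K) := by gcongr
        _ ≤ √(T.sigma k) * ((1 - p.eta1) * (p.tau * p.muInit * p.zeta)) := hR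
        _ ≤ √(T.sigma k) * ((1 - p.eta1) * (√(T.sigma k) * (2 * K) * T.redq Q k)) := by gcongr
        _ = √(T.sigma k) ^ 2 * (2 * K) * ((1 - p.eta1) * T.redq Q k) := by ring
        _ = _ := by rw [Real.sq_sqrt hsig.le]
    rw [Trace.rho, le_div_iff₀ hq]
    have := h.merit_sub_trial_ge hk
    linarith

lemma sigma_le (hg : 0 ≤ epsg) (hc : 0 ≤ epsc) (hH : 0 ≤ epsH) :
    ∀ k, T.Reached Q epsg epsc epsH k →
      T.sigma k ≤ max p.sigma0 (p.gamma2 * p.sigmaThreshold m K) := by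
  intro k
  induction k with
  | zero => intro _; rw [h.run.init]; exact le_max_left _ _
  | succ k ih =>
    intro hk
    have h1 := ih (hk.mono k.le_succ)
    have hs := h.run.sigma k hk
    by_cases hS : T.Successful p Q k
    · rcases lt_or_ge p.eta2 (T.ratio p Q k) with h2 | h2
      · exact (hs.verySuccessful hS h2).2.trans h1
      · rw [hs.successful hS h2]; exact h1
    · refine (hs.unsuccessful hS).2.trans (le_trans ?_ (le_max_right _ _))
      have h2 : T.sigma k < p.sigmaThreshold m K := by
        by_contra h0
        exact hS (h.successful_of_sigmaThreshold_le hg hc hH hk (not_lt.1 h0))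
      have : 0 < p.gamma2 := by have := p.gamma1_gt; have := p.gamma2_gt; linarith
      gcongr

end RegularRun

/-! ### Decrease over two consecutive successful iterations -/

/-- A bound for the accepted steps in units of `‖d‖`. -/
noncomputable def Params.acceptedBound (p : Params) (K : ℝ) : ℝ :=
  1 + p.corrBound K * p.trialBound K

/-- A bound, in units of `‖d‖²`, for the tangential part of the gradient of the Lagrangian after an
accepted step, if the regularization parameter is at most `S`. -/
noncomputable def Params.gradBound (p : Params) (K S : ℝ) : ℝ :=
  p.hessBound K * p.acceptedBound K ^ 2 + 2 * S + p.hessBound K * p.corrBound K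
    + K * p.acceptedBound K * (K ^ 2 * (p.rlam + K * p.hessBound K))

/-- The rate of decrease of the model over two consecutive successful iterations. The five
constants belong to the five possible reasons: a large constraint violation, negative curvature, and
a large gradient of the Lagrangian caused by the tangential step, by the normal step, or by the
inexact multipliers. -/
noncomputable def Params.decreaseRate (p : Params) (K S : ℝ) : ℝ :=
  min (p.tau * p.muInit * min 1 (p.theta / (2 * K ^ 2 * √S)))
    (min ((1 / 6 - p.delta) / S ^ 2)
      (min ((1 / 6 - p.delta) * p.sigmaMin / √(3 * p.gradBound K S) ^ 3)
        (min (p.tau * p.muInit / (2 * K) / √(3 * p.gradBound K S))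
          (p.tau * p.muInit / (2 * K) / (3 * (K * p.rlam + 1))))))

lemma Params.acceptedBound_pos (p : Params) {K : ℝ} (hK : 1 ≤ K) : 0 < p.acceptedBound K := by
  have := p.corrBound_pos hK
  have := p.trialBound_pos hK
  unfold Params.acceptedBound
  positivity

lemma Params.gradBound_pos (p : Params) {K S : ℝ} (hK : 1 ≤ K) (hS : 0 < S) :
    0 < p.gradBound K S := by
  have := p.one_le_hessBound hK
  have := p.acceptedBound_pos hK
  have := p.corrBound_pos hK
  have := p.rlam_nonneg
  unfold Params.gradBound
  positivity

lemma Params.decreaseRate_pos (p : Params) {K S : ℝ} (hK : 1 ≤ K) (hS : 0 < S) :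
    0 < p.decreaseRate K S := by
  have := p.gradBound_pos hK hS
  have := p.rlam_nonneg
  have := p.tau_pos
  have := p.muInit_pos
  have := p.theta_pos
  have := p.sigmaMin_pos
  have : 0 < 1 / 6 - p.delta := by have := p.delta_lt; linarith
  unfold Params.decreaseRate
  exact lt_min (mul_pos (by positivity) (lt_min one_pos (by positivity)))
    (lt_min (by positivity) (lt_min (by positivity) (lt_min (by positivity) (by positivity))))

namespace RegularRun

variable {n m : ℕ} {p : Params} {Q : Problem n m} {T : Trace n m} {X : Set (Vec n)}
  {K epsg epsc epsH : ℝ} {j k : ℕ} (h : RegularRun p Q T X K epsg epsc epsH)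

include h

lemma exists_accepted_step (hk : T.Reached Q epsg epsc epsH (k + 1)) (hS : T.Successful p Q k) :
    ∃ e, T.x (k + 1) = T.x k + (T.d k + e) ∧ ‖e‖ ≤ p.corrBound K * ‖T.d k‖ ^ 2 := by
  by_cases h1 : p.eta1 ≤ T.rho Q k
  · refine ⟨0, by rw [add_zero]; exact (h.run.iterate k hk).plain h1, ?_⟩
    have := p.corrBound_pos h.bounds.one_le
    rw [norm_zero]
    positivity
  · have h2 := hS.resolve_left h1
    exact ⟨T.w k, by rw [← add_assoc]; exact (h.run.iterate k hk).corrected h2.1 h2.2,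
      h.norm_w_le hk h2.1⟩

lemma eta1_mul_redq_le (hg : 0 ≤ epsg) (hc : 0 ≤ epsc) (hH : 0 ≤ epsH)
    (hk : T.Reached Q epsg epsc epsH (k + 1)) (hS : T.Successful p Q k) :
    p.eta1 * T.redq Q k ≤ Q.merit (T.x k) (T.mu k) - Q.merit (T.x (k + 1)) (T.mu k) := by
  have hq := h.redq_pos hg hc hH hk
  by_cases h1 : p.eta1 ≤ T.rho Q k
  · rw [(h.run.iterate k hk).plain h1, ← le_div_iff₀ hq]
    exact h1
  · have h2 := hS.resolve_left h1
    rw [(h.run.iterate k hk).corrected h2.1 h2.2, ← le_div_iff₀ hq]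
    exact h2.2

/-- The gradient of the Lagrangian after an accepted step, with suitable multipliers, is of second
order: the multipliers are moved by `η` with `A(x)ᵀ η` the component of the linearized gradient
in the range of `A(x)ᵀ`, so that only its component in the null space is left. -/
lemma exists_norm_gradLag_le {S : ℝ} (hk : T.Reached Q epsg epsc epsH (k + 1))
    (hs : T.sigma k ≤ S) (hS : T.Successful p Q k) :
    ∃ lam, ‖gradient Q.f (T.x (k + 1)) + (Q.A (T.x (k + 1))).adjoint lam‖
      ≤ p.gradBound K S * ‖T.d k‖ ^ 2 := by
  have hk' := hk.mono k.le_succ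
  have hx := h.x_mem hk'
  have hy := h.x_mem hk
  have hK := h.K_pos
  have hB := p.one_le_hessBound h.bounds.one_le
  have hW := p.corrBound_pos h.bounds.one_le
  have hD := p.trialBound_pos h.bounds.one_le
  have hr := p.rlam_nonneg
  have hsig := h.sigma_pos hk'
  obtain ⟨e, hxe, he⟩ := h.exists_accepted_step hk hS
  rw [hxe] at hy ⊢
  set s := T.d k + e with hs_def
  set z := T.g Q k + (Q.A (T.x k)).adjoint (T.lam k) + T.H Q k (T.d k) with hz
  obtain ⟨η, hη⟩ : z - Q.P (T.x k) z ∈ (Q.A (T.x k)).adjoint.range :=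
    mem_range_adjoint_of_orthogonal (Submodule.sub_starProjection_mem_orthogonal z)
  change (Q.A (T.x k)).adjoint η = z - Q.P (T.x k) z at hη
  have hs_norm : ‖s‖ ≤ p.acceptedBound K * ‖T.d k‖ := by
    have h1 := h.norm_d_le hk
    calc ‖s‖ ≤ ‖T.d k‖ + ‖e‖ := norm_add_le _ _
      _ ≤ ‖T.d k‖ + p.corrBound K * (p.trialBound K * ‖T.d k‖) := by
        gcongr
        refine he.trans ?_
        rw [pow_two]
        gcongr
      _ = _ := by rw [Params.acceptedBound]; ring
  have hη_norm : ‖η‖ ≤ K ^ 2 * (p.rlam + K * p.hessBound K) * ‖T.d k‖ := by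
    have h1 := norm_le_sq_of_adjoint hK.le (h.bounds.adj _ hx) η
    have h2 : Q.A (T.x k) ((Q.A (T.x k)).adjoint η)
        = Q.A (T.x k) (T.g Q k + Q.AT (T.x k) (T.lam k)) + Q.A (T.x k) (T.H Q k (T.d k)) := by
      have h3 : Q.A (T.x k) (Q.P (T.x k) z) = 0 :=
        Submodule.starProjection_apply_mem (Q.null (T.x k)) z
      rw [hη, map_sub, h3, sub_zero, hz, map_add]
      rfl
    rw [h2] at h1
    calc ‖η‖ ≤ _ := h1
      _ ≤ K ^ 2 * (p.rlam * ‖T.d k‖ + K * (p.hessBound K * ‖T.d k‖)) := by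
        gcongr
        refine (norm_add_le _ _).trans (add_le_add ?_ ?_)
        · exact (h.run.multipliers k hk').trans (by gcongr; exact h.norm_v_le_norm_d hk)
        · exact (h.bounds.A_le _ hx _).trans (by gcongr; exact h.norm_H_le hk' _)
      _ = _ := by ring
  have hPz : ‖Q.P (T.x k) z‖ ≤ 2 * S * ‖T.d k‖ ^ 2 := by
    have h1 : Q.P (T.x k) z = Q.P (T.x k) (T.g Q k + T.H Q k (T.d k)) := by
      rw [hz, add_right_comm, map_add, P_adjoint, add_zero]
    have h2 := h.norm_projected_model_gradient_le hk
    have h3 := norm_sub_le (Q.P (T.x k) (T.g Q k + T.H Q k (T.d k))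
      + (T.sigma k * ‖T.u k‖) • T.u k) ((T.sigma k * ‖T.u k‖) • T.u k)
    rw [add_sub_cancel_right, norm_smul (T.sigma k * ‖T.u k‖),
      Real.norm_of_nonneg (by positivity)] at h3
    have h5 : 0 ≤ S := hsig.le.trans hs
    have h4 : p.delta ≤ 1 := by have := p.delta_lt; linarith
    rw [h1]
    calc _ ≤ p.delta * T.sigma k * ‖T.u k‖ ^ 2 + T.sigma k * ‖T.u k‖ * ‖T.u k‖ := by linarith
      _ ≤ 1 * T.sigma k * ‖T.u k‖ ^ 2 + T.sigma k * ‖T.u k‖ * ‖T.u k‖ := by gcongr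
      _ = 2 * T.sigma k * ‖T.u k‖ ^ 2 := by ring
      _ ≤ 2 * S * ‖T.d k‖ ^ 2 := by gcongr; exact h.norm_u_le_norm_d hk
  refine ⟨T.lam k - η, ?_⟩
  have h1 := h.bounds.grad_taylor _ hx _ hy (T.lam k)
  have h2 := h.bounds.adj_lip _ hx _ hy η
  rw [add_sub_cancel_left] at h1 h2
  have e1 : gradient Q.f (T.x k + s) + (Q.A (T.x k + s)).adjoint (T.lam k - η)
      = ((gradient Q.f (T.x k + s) + (Q.A (T.x k + s)).adjoint (T.lam k))
          - (gradient Q.f (T.x k) + (Q.A (T.x k)).adjoint (T.lam k))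
          - Q.H (T.x k) (T.lam k) s)
        + Q.P (T.x k) z + T.H Q k e
        - ((Q.A (T.x k + s)).adjoint η - (Q.A (T.x k)).adjoint η) := by
    have h3 : Q.H (T.x k) (T.lam k) s = T.H Q k (T.d k) + T.H Q k e := map_add _ _ _
    rw [hη, h3, hz, map_sub, show gradient Q.f (T.x k) = T.g Q k from rfl]
    abel
  have b1 : K * (1 + ‖T.lam k‖) * ‖s‖ ^ 2
      ≤ p.hessBound K * p.acceptedBound K ^ 2 * ‖T.d k‖ ^ 2 := by
    calc _ ≤ p.hessBound K * (p.acceptedBound K * ‖T.d k‖) ^ 2 := by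
          gcongr; exact h.K_mul_le_hessBound hk'
      _ = _ := by ring
  have b2 : ‖T.H Q k e‖ ≤ p.hessBound K * p.corrBound K * ‖T.d k‖ ^ 2 := by
    calc _ ≤ p.hessBound K * ‖e‖ := h.norm_H_le hk' e
      _ ≤ p.hessBound K * (p.corrBound K * ‖T.d k‖ ^ 2) := by gcongr
      _ = _ := by ring
  have b3 : K * ‖s‖ * ‖η‖
      ≤ K * p.acceptedBound K * (K ^ 2 * (p.rlam + K * p.hessBound K)) * ‖T.d k‖ ^ 2 := by
    have := p.acceptedBound_pos h.bounds.one_le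
    calc _ ≤ K * (p.acceptedBound K * ‖T.d k‖)
          * (K ^ 2 * (p.rlam + K * p.hessBound K) * ‖T.d k‖) := by gcongr
      _ = _ := by ring
  rw [e1, Params.gradBound]
  refine (norm_sub_le _ _).trans ((add_le_add_left ((norm_add_le _ _).trans
    (add_le_add_left (norm_add_le _ _) _)) _).trans ?_)
  linarith

/-- The gradient of the Lagrangian at the next successful iteration. -/
lemma norm_gradLag_le {S : ℝ} (hj : T.Reached Q epsg epsc epsH (j + 1))
    (hk : T.Reached Q epsg epsc epsH (k + 1)) (hs : T.sigma j ≤ S) (hS : T.Successful p Q j)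
    (hx : T.x k = T.x (j + 1)) :
    ‖Q.gradLag (T.x k) (T.lam k)‖
      ≤ p.gradBound K S * (‖T.v j‖ ^ 2 + ‖T.u j‖ ^ 2) + K * p.rlam * ‖T.v k‖ := by
  have hk' := hk.mono k.le_succ
  have hxk := h.x_mem hk'
  obtain ⟨lam, hlam⟩ := h.exists_norm_gradLag_le hj hs hS
  rw [← hx, h.norm_d_sq hj] at hlam
  rw [h.bounds.gradLag_eq _ hxk]
  set y := gradient Q.f (T.x k) + (Q.A (T.x k)).adjoint (T.lam k) with hy
  have h1 : Q.P (T.x k) y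
      = Q.P (T.x k) (gradient Q.f (T.x k) + (Q.A (T.x k)).adjoint lam) := by
    rw [hy, map_add, map_add, P_adjoint, P_adjoint]
  have h2 : ‖Q.P (T.x k) y‖ ≤ ‖gradient Q.f (T.x k) + (Q.A (T.x k)).adjoint lam‖ := by
    rw [h1]; exact Submodule.norm_starProjection_apply_le _ _
  have h3 : ‖y - Q.P (T.x k) y‖ ≤ K * ‖Q.A (T.x k) (y - Q.P (T.x k) y)‖ :=
    norm_le_of_mem_range_adjoint (h.bounds.adj _ hxk)
      (mem_range_adjoint_of_orthogonal (Submodule.sub_starProjection_mem_orthogonal y))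
  have h4 : Q.A (T.x k) (Q.P (T.x k) y) = 0 :=
    Submodule.starProjection_apply_mem (Q.null (T.x k)) y
  rw [map_sub, h4, sub_zero] at h3
  have h5 := mul_le_mul_of_nonneg_left (h.run.multipliers k hk') h.K_pos.le
  have h6 := norm_add_le (y - Q.P (T.x k) y) (Q.P (T.x k) y)
  rw [sub_add_cancel] at h6
  have h7 : T.g Q k + Q.AT (T.x k) (T.lam k) = y := rfl
  rw [h7] at h5
  linarith

lemma redq_ge_norm_u (hk : T.Reached Q epsg epsc epsH (k + 1)) :
    (1 / 6 - p.delta) * (T.sigma k * ‖T.u k‖ ^ 3) ≤ T.redq Q k := by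
  refine le_trans ?_ (h.redq_ge hk)
  have h1 := p.tau_pos
  have h2 := h.mu_pos hk
  have h3 := h.beta_pos (hk.mono k.le_succ)
  have h4 := l1_nonneg (Q.c (T.x k))
  exact le_add_of_nonneg_right (by positivity)

lemma redq_ge_l1 (hk : T.Reached Q epsg epsc epsH (k + 1)) :
    p.tau * p.muInit * (T.beta k * l1 (Q.c (T.x k))) ≤ T.redq Q k := by
  refine le_trans ?_ (h.redq_ge hk)
  have h1 := p.tau_pos
  have h3 := h.beta_pos (hk.mono k.le_succ)
  have h4 := l1_nonneg (Q.c (T.x k))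
  have h5 := h.sigma_pos (hk.mono k.le_succ)
  have h6 : 0 ≤ 1 / 6 - p.delta := by have := p.delta_lt; linarith
  have h7 : 0 ≤ (1 / 6 - p.delta) * (T.sigma k * ‖T.u k‖ ^ 3) := by positivity
  have h8 : p.tau * p.muInit * (T.beta k * l1 (Q.c (T.x k)))
      ≤ p.tau * T.mu k * (T.beta k * l1 (Q.c (T.x k))) := by
    gcongr; exact h.muInit_le_mu hk
  linarith

lemma redq_ge_norm_v (hk : T.Reached Q epsg epsc epsH (k + 1)) :
    p.tau * p.muInit / (2 * K) * ‖T.v k‖ ≤ T.redq Q k := by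
  refine le_trans ?_ (h.redq_ge_l1 hk)
  have h1 := p.tau_pos
  have h2 := p.muInit_pos
  have h3 := h.K_pos
  calc p.tau * p.muInit / (2 * K) * ‖T.v k‖
      ≤ p.tau * p.muInit / (2 * K) * (2 * K * (T.beta k * l1 (Q.c (T.x k)))) := by
        gcongr; exact h.norm_v_le (hk.mono k.le_succ)
    _ = _ := by field_simp

lemma min_le_beta {S : ℝ} (hk : T.Reached Q epsg epsc epsH k) (hs : T.sigma k ≤ S) :
    min 1 (p.theta / (2 * K ^ 2 * √S)) ≤ T.beta k := by
  by_cases hc : Q.c (T.x k) = 0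
  · rw [((h.run.normal k hk).feasible hc).2]; exact min_le_left _ _
  · refine le_trans (min_le_min le_rfl ?_) ((h.run.normal k hk).beta_ge hc)
    have h1 := norm_pos_iff.2 (h.vc_ne_zero hk hc)
    have h2 := Real.sqrt_pos.2 (h.sigma_pos hk)
    have h3 := p.theta_pos
    have h4 := h.norm_vc_le_sq hk
    have h5 := Real.sqrt_le_sqrt hs
    gcongr

/-- A nonstationary successful iteration `k` and the successful iteration `j` before it together
decrease the model by a multiple of the target accuracy. The constraint violation and the curvature
at `k` are seen by the step computed at `k`, the gradient of the Lagrangian at `k` also by the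
step computed at `j`. -/
lemma decreaseRate_mul_le {S eps : ℝ} (hS0 : 0 < S) (hg : epsg ∈ Set.Ioo (0 : ℝ) 1)
    (hj : T.Reached Q epsg epsc epsH (j + 1)) (hk : T.Reached Q epsg epsc epsH (k + 1))
    (hsj : T.sigma j ≤ S) (hsk : T.sigma k ≤ S) (hS : T.Successful p Q j)
    (hx : T.x k = T.x (j + 1)) (hH0 : 0 ≤ epsH) (heps : 0 ≤ eps) (e1 : eps ≤ √epsg ^ 3)
    (e2 : eps ≤ epsc) (e3 : eps ≤ epsH ^ 3) :
    p.decreaseRate K S * eps ≤ T.redq Q j + T.redq Q k := by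
  have hk' := hk.mono k.le_succ
  have hqj := h.redq_nonneg hj
  have hqk := h.redq_nonneg hk
  have hK := h.K_pos
  have hG := p.gradBound_pos h.bounds.one_le hS0
  have htau := p.tau_pos
  have hmu := p.muInit_pos
  have hth := p.theta_pos
  have hsm := p.sigmaMin_pos
  have hrl := p.rlam_nonneg
  have hd : 0 < 1 / 6 - p.delta := by have := p.delta_lt; linarith
  have hsg := h.sigma_pos hk'
  set α := p.decreaseRate K S with hα
  unfold Params.decreaseRate at hα
  have a1 : α ≤ _ := hα.trans_le (min_le_left _ _)
  have a1' : α ≤ _ := hα.trans_le (min_le_right _ _)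
  have a2 : α ≤ _ := a1'.trans (min_le_left _ _)
  have a2' : α ≤ _ := a1'.trans (min_le_right _ _)
  have a3 : α ≤ _ := a2'.trans (min_le_left _ _)
  have a3' : α ≤ _ := a2'.trans (min_le_right _ _)
  have a4 : α ≤ _ := a3'.trans (min_le_left _ _)
  have a5 : α ≤ _ := a3'.trans (min_le_right _ _)
  by_cases hc : l1 (Q.c (T.x k)) ≤ epsc
  swap
  · have h1 := h.redq_ge_l1 hk
    have h2 := h.min_le_beta hk' hsk
    calc α * eps ≤ p.tau * p.muInit * min 1 (p.theta / (2 * K ^ 2 * √S)) * eps := by gcongr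
      _ = p.tau * p.muInit * (min 1 (p.theta / (2 * K ^ 2 * √S)) * eps) := by ring
      _ ≤ p.tau * p.muInit * (T.beta k * l1 (Q.c (T.x k))) := by
        have := h.beta_pos hk'
        gcongr
        linarith
      _ ≤ _ := by linarith
  by_cases hH : -epsH ≤ minEig (Q.reducedHess (T.x k) (T.lam k))
  swap
  · have h1 := h.redq_ge_norm_u hk
    have h2 := h.neg_sigma_norm_u_le_minEig hk
    have h3 : epsH ≤ T.sigma k * ‖T.u k‖ := by linarith
    calc α * eps ≤ (1 / 6 - p.delta) / S ^ 2 * eps := by gcongr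
      _ ≤ (1 / 6 - p.delta) / T.sigma k ^ 2 * (T.sigma k * ‖T.u k‖) ^ 3 := by
        gcongr
        exact e3.trans (by gcongr)
      _ = (1 / 6 - p.delta) * (T.sigma k * ‖T.u k‖ ^ 3) := by field_simp
      _ ≤ _ := by linarith
  have hgr : epsg < ‖Q.gradLag (T.x k) (T.lam k)‖ := by
    by_contra h0
    exact hk k (Nat.lt_succ_self k) ⟨not_lt.1 h0, hc, hH⟩
  have hb := hgr.trans_le (h.norm_gradLag_le hj hk hsj hS hx)
  set a := √epsg with ha
  have ha0 : 0 < a := Real.sqrt_pos.2 hg.1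
  have ha1 : a ≤ 1 := Real.sqrt_le_one.2 hg.2.le
  have ha2 : epsg = a ^ 2 := (Real.sq_sqrt hg.1.le).symm
  have hr : 0 < √(3 * p.gradBound K S) := Real.sqrt_pos.2 (by positivity)
  have hr2 : √(3 * p.gradBound K S) ^ 2 = 3 * p.gradBound K S := Real.sq_sqrt (by positivity)
  set r := √(3 * p.gradBound K S) with hr_def
  have hdiv : ∀ {t : ℝ}, 0 ≤ t → epsg / 3 ≤ p.gradBound K S * t ^ 2 → a / r ≤ t := by
    intro t ht h0
    rw [div_le_iff₀ hr]
    refine (sq_le_sq₀ ha0.le (by positivity)).1 ?_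
    rw [mul_pow, hr2, ← ha2]
    linarith
  rcases le_or_gt (epsg / 3) (p.gradBound K S * ‖T.u j‖ ^ 2) with hu | hu
  · have h1 := h.redq_ge_norm_u hj
    have h2 := hdiv (norm_nonneg _) hu
    calc α * eps ≤ (1 / 6 - p.delta) * p.sigmaMin / r ^ 3 * eps := by gcongr
      _ ≤ (1 / 6 - p.delta) * p.sigmaMin / r ^ 3 * a ^ 3 := by gcongr
      _ = (1 / 6 - p.delta) * (p.sigmaMin * (a / r) ^ 3) := by ring
      _ ≤ (1 / 6 - p.delta) * (T.sigma j * ‖T.u j‖ ^ 3) := by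
        have := h.sigmaMin_le j (hj.mono j.le_succ)
        have := h.sigma_pos (hj.mono j.le_succ)
        gcongr
      _ ≤ _ := by linarith
  rcases le_or_gt (epsg / 3) (p.gradBound K S * ‖T.v j‖ ^ 2) with hv | hv
  · have h1 := h.redq_ge_norm_v hj
    have h2 := hdiv (norm_nonneg _) hv
    calc α * eps ≤ p.tau * p.muInit / (2 * K) / r * eps := by gcongr
      _ ≤ p.tau * p.muInit / (2 * K) / r * a := by
        gcongr
        exact e1.trans (pow_le_of_le_one ha0.le ha1 (by norm_num))
      _ = p.tau * p.muInit / (2 * K) * (a / r) := by ring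
      _ ≤ p.tau * p.muInit / (2 * K) * ‖T.v j‖ := by gcongr
      _ ≤ _ := by linarith
  · have h1 := h.redq_ge_norm_v hk
    have h2 : epsg / (3 * (K * p.rlam + 1)) ≤ ‖T.v k‖ := by
      rw [div_le_iff₀ (by positivity)]
      have := norm_nonneg (T.v k)
      linarith
    calc α * eps ≤ p.tau * p.muInit / (2 * K) / (3 * (K * p.rlam + 1)) * eps := by gcongr
      _ ≤ p.tau * p.muInit / (2 * K) / (3 * (K * p.rlam + 1)) * epsg := by
        gcongr
        rw [ha2]
        exact e1.trans (pow_le_pow_of_le_one ha0.le ha1 (by norm_num))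
      _ = p.tau * p.muInit / (2 * K) * (epsg / (3 * (K * p.rlam + 1))) := by ring
      _ ≤ p.tau * p.muInit / (2 * K) * ‖T.v k‖ := by gcongr
      _ ≤ _ := by linarith

end RegularRun

/-! ### Counting iterations -/

open Classical in
/-- The successful iterations among the first `N`. -/
noncomputable def successes {n m : ℕ} (p : Params) (Q : Problem n m) (T : Trace n m) (N : ℕ) :
    Finset ℕ := {j ∈ Finset.range N | T.Successful p Q j}

section Successes

variable {n m : ℕ} {p : Params} {Q : Problem n m} {T : Trace n m}

lemma coe_successes (N : ℕ) :
    (successes p Q T N : Set ℕ) = {j : ℕ | j < N ∧ T.Successful p Q j} := by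
  ext j; simp [successes]

lemma successes_succ_of_successful {N : ℕ} (hS : T.Successful p Q N) :
    successes p Q T (N + 1) = insert N (successes p Q T N) := by
  simp [successes, Finset.range_add_one, Finset.filter_insert, hS]

lemma successes_succ_of_not_successful {N : ℕ} (hS : ¬ T.Successful p Q N) :
    successes p Q T (N + 1) = successes p Q T N := by
  simp [successes, Finset.range_add_one, Finset.filter_insert, hS]

lemma notMem_successes (N : ℕ) : N ∉ successes p Q T N := by simp [successes]

end Successes

namespace RegularRun

variable {n m : ℕ} {p : Params} {Q : Problem n m} {T : Trace n m} {X : Set (Vec n)}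
  {K epsg epsc epsH : ℝ} (h : RegularRun p Q T X K epsg epsc epsH)

include h

/-- The total model decrease is bounded: the merit function telescopes up to the changes of the
merit parameter, which is nondecreasing. -/
lemma eta1_mul_sum_redq_le {κ : ℝ} (hκ : ∀ x ∈ X, l1 (Q.c x) ≤ κ) (hg : 0 ≤ epsg) (hc : 0 ≤ epsc)
    (hH : 0 ≤ epsH) : ∀ N, T.Reached Q epsg epsc epsH N →
      p.eta1 * ∑ j ∈ successes p Q T N, T.redq Q j + Q.merit (T.x N) (T.muPrev p N)
        ≤ Q.f (T.x 0) + T.muPrev p N * κ := by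
  intro N
  induction N with
  | zero =>
    intro hN
    have h1 := mul_le_mul_of_nonneg_left (hκ _ (h.x_mem hN)) p.muInit_pos.le
    simp only [successes, Finset.range_zero, Finset.filter_empty, Finset.sum_empty, mul_zero,
      Problem.merit, Trace.muPrev]
    linarith
  | succ N ih =>
    intro hN
    have hN' := hN.mono N.le_succ
    have h1 := ih hN'
    have h2 := mul_le_mul_of_nonneg_left (hκ _ (h.x_mem hN'))
      (sub_nonneg.2 (h.muPrev_le_mu hN))
    have h3 : T.muPrev p (N + 1) = T.mu N := rfl
    have h4 : Q.merit (T.x N) (T.mu N) = Q.merit (T.x N) (T.muPrev p N)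
        + (T.mu N - T.muPrev p N) * l1 (Q.c (T.x N)) := by
      simp only [Problem.merit]; ring
    rw [h3]
    by_cases hS : T.Successful p Q N
    · have h5 := h.eta1_mul_redq_le hg hc hH hN hS
      rw [successes_succ_of_successful hS, Finset.sum_insert (notMem_successes N), mul_add]
      linarith
    · rw [successes_succ_of_not_successful hS, (h.run.iterate N hN).rejected hS]
      linarith

/-- All successful iterations but one contribute to the model decrease; the last successful
iteration is kept aside, as its own contribution shows only in the next one. -/
lemma card_sub_one_mul_le {S eps : ℝ} (hS0 : 0 < S) (hg : epsg ∈ Set.Ioo (0 : ℝ) 1)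
    (hH0 : 0 ≤ epsH) (heps : 0 ≤ eps) (e1 : eps ≤ √epsg ^ 3)
    (e2 : eps ≤ epsc) (e3 : eps ≤ epsH ^ 3)
    (hsig : ∀ k, T.Reached Q epsg epsc epsH k → T.sigma k ≤ S) :
    ∀ N, T.Reached Q epsg epsc epsH N →
      successes p Q T N = ∅ ∨ ∃ j < N, T.Successful p Q j ∧ T.x N = T.x (j + 1) ∧
        ((successes p Q T N).card - 1 : ℝ) * (p.decreaseRate K S * eps) + T.redq Q j
          ≤ 2 * ∑ i ∈ successes p Q T N, T.redq Q i := by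
  intro N
  induction N with
  | zero => intro _; left; simp [successes]
  | succ N ih =>
    intro hN
    have hN' := hN.mono N.le_succ
    by_cases hS : T.Successful p Q N
    · right
      refine ⟨N, N.lt_succ_self, hS, rfl, ?_⟩
      rw [successes_succ_of_successful hS, Finset.sum_insert (notMem_successes N),
        Finset.card_insert_of_notMem (notMem_successes N)]
      have hq := h.redq_nonneg hN
      rcases ih hN' with h0 | ⟨j, hj, hSj, hx, h1⟩
      · rw [h0, Finset.card_empty, Finset.sum_empty]
        push_cast
        linarith
      · have hjN : T.Reached Q epsg epsc epsH (j + 1) := hN'.mono hj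
        have h2 := h.decreaseRate_mul_le hS0 hg hjN hN (hsig _ (hjN.mono j.le_succ))
          (hsig _ hN') hSj hx hH0 heps e1 e2 e3
        push_cast
        linarith
    · rw [successes_succ_of_not_successful hS, (h.run.iterate N hN).rejected hS]
      rcases ih hN' with h0 | ⟨j, hj, hr⟩
      · exact Or.inl h0
      · exact Or.inr ⟨j, hj.trans N.lt_succ_self, hr⟩

/-- The regularization parameter grows at every unsuccessful iteration, so that its upper bound
limits the number of iterations in terms of the number of successful ones. -/
lemma mul_log_gamma1_le : ∀ N, T.Reached Q epsg epsc epsH N →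
    N * Real.log p.gamma1 ≤ (successes p Q T N).card * (Real.log p.gamma1 - Real.log p.gamma3)
      + Real.log (T.sigma N / p.sigma0) := by
  have hs0 : 0 < p.sigma0 := p.sigmaMin_pos.trans_le p.sigmaMin_le
  have hg1 := zero_lt_one.trans p.gamma1_gt
  intro N
  induction N with
  | zero => intro _; rw [h.run.init]; simp [successes, hs0.ne']
  | succ N ih =>
    intro hN
    have hN' := hN.mono N.le_succ
    have h1 := ih hN'
    have hp := h.sigma_pos hN'
    have hu := h.run.sigma N hN
    have key : ∀ {a : ℝ}, 0 < a → a * T.sigma N ≤ T.sigma (N + 1) →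
        Real.log a + Real.log (T.sigma N / p.sigma0) ≤ Real.log (T.sigma (N + 1) / p.sigma0) := by
      intro a ha h2
      rw [← Real.log_mul ha.ne' (by positivity), ← mul_div_assoc]
      exact Real.log_le_log (by positivity) (by gcongr)
    by_cases hS : T.Successful p Q N
    · have h2 : p.gamma3 * T.sigma N ≤ T.sigma (N + 1) := by
        rcases lt_or_ge p.eta2 (T.ratio p Q N) with h3 | h3
        · exact (le_max_right _ _).trans (hu.verySuccessful hS h3).1
        · rw [hu.successful hS h3]
          exact mul_le_of_le_one_left hp.le p.gamma3_le
      have h4 := key p.gamma3_pos h2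
      rw [successes_succ_of_successful hS, Finset.card_insert_of_notMem (notMem_successes N)]
      push_cast
      linarith
    · have h4 := key hg1 (hu.unsuccessful hS).1
      rw [successes_succ_of_not_successful hS]
      push_cast
      linarith

end RegularRun

lemma one_le_rate {epsg epsc epsH : ℝ} (hc : epsc ∈ Set.Ioo (0 : ℝ) 1) :
    1 ≤ rate epsg epsc epsH := by
  refine le_trans ?_ ((le_max_left _ _).trans (le_max_right _ _))
  rw [Real.rpow_neg_one]
  exact (one_le_inv₀ hc.1).2 hc.2.le

lemma inv_rate_le_sqrt_pow {epsg epsc epsH : ℝ} (hg : epsg ∈ Set.Ioo (0 : ℝ) 1) :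
    (rate epsg epsc epsH)⁻¹ ≤ √epsg ^ 3 := by
  have h0 : (√epsg ^ 3)⁻¹ = epsg ^ (-(3 / 2) : ℝ) := by
    rw [Real.sqrt_eq_rpow, ← Real.rpow_natCast, ← Real.rpow_mul hg.1.le, Real.rpow_neg hg.1.le]
    norm_num
  have h1 := Real.sqrt_pos.2 hg.1
  refine inv_le_of_inv_le₀ (by positivity) ?_
  rw [h0]
  exact le_max_left _ _

lemma inv_rate_le {epsg epsc epsH : ℝ} (hc : epsc ∈ Set.Ioo (0 : ℝ) 1) :
    (rate epsg epsc epsH)⁻¹ ≤ epsc := by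
  refine inv_le_of_inv_le₀ hc.1 ?_
  rw [← Real.rpow_neg_one]
  exact (le_max_left _ _).trans (le_max_right _ _)

lemma inv_rate_le_pow {epsg epsc epsH : ℝ} (hH : epsH ∈ Set.Ioo (0 : ℝ) 1) :
    (rate epsg epsc epsH)⁻¹ ≤ epsH ^ 3 := by
  have h0 : (epsH ^ 3)⁻¹ = epsH ^ (-3 : ℝ) := by
    rw [Real.rpow_neg hH.1.le]; norm_cast
  have h1 := hH.1
  refine inv_le_of_inv_le₀ (by positivity) ?_
  rw [h0]
  exact (le_max_right _ _).trans (le_max_right _ _)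

/-- The number of successful iterations before the run has stopped. -/
lemma RegularRun.card_sub_one_le {n m : ℕ} {p : Params} {Q : Problem n m} {T : Trace n m}
    {X : Set (Vec n)} {K epsg epsc epsH S κ flow : ℝ} (h : RegularRun p Q T X K epsg epsc epsH)
    (hS0 : 0 < S) (hg : epsg ∈ Set.Ioo (0 : ℝ) 1) (hc : epsc ∈ Set.Ioo (0 : ℝ) 1)
    (hH : epsH ∈ Set.Ioo (0 : ℝ) 1) (hsig : ∀ k, T.Reached Q epsg epsc epsH k → T.sigma k ≤ S)
    (hκ : ∀ x ∈ X, l1 (Q.c x) ≤ κ) (hflow : ∀ k, T.Reached Q epsg epsc epsH k → flow ≤ Q.f (T.x k))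
    {N : ℕ} (hN : T.Reached Q epsg epsc epsH N) :
    ((successes p Q T N).card - 1 : ℝ)
      ≤ 2 * (Q.f (T.x 0) - flow + 2 * κ * p.meritBound K) / (p.eta1 * p.decreaseRate K S)
        * rate epsg epsc epsH := by
  have hα := p.decreaseRate_pos h.bounds.one_le hS0
  have hη := p.eta1_pos
  have hR := one_le_rate (epsg := epsg) (epsH := epsH) hc
  have hR0 : 0 < rate epsg epsc epsH := zero_lt_one.trans_le hR
  have hκ0 : 0 ≤ κ := (l1_nonneg _).trans (hκ _ (h.x_mem hN))
  have hM := p.meritBound_pos K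
  have h1 := h.eta1_mul_sum_redq_le hκ hg.1.le hc.1.le hH.1.le N hN
  have h2 : p.eta1 * ∑ j ∈ successes p Q T N, T.redq Q j
      ≤ Q.f (T.x 0) - flow + 2 * κ * p.meritBound K := by
    have h3 := hflow N hN
    have h4 := mul_le_mul_of_nonneg_right (h.muPrev_le_meritBound N hN) hκ0
    have h5 := mul_nonneg (p.muInit_pos.le.trans (h.muInit_le_muPrev N hN))
      (l1_nonneg (Q.c (T.x N)))
    have h6 := mul_nonneg hκ0 hM.le
    rw [Problem.merit] at h1
    linarith
  have h3 : ((successes p Q T N).card - 1 : ℝ) * (p.decreaseRate K S * (rate epsg epsc epsH)⁻¹)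
      ≤ 2 * ∑ j ∈ successes p Q T N, T.redq Q j := by
    rcases h.card_sub_one_mul_le hS0 hg hH.1.le (inv_nonneg.2 hR0.le) (inv_rate_le_sqrt_pow hg)
      (inv_rate_le hc) (inv_rate_le_pow hH) hsig N hN with h0 | ⟨j, hj, -, -, h4⟩
    · rw [h0, Finset.card_empty, Finset.sum_empty]
      have : 0 ≤ p.decreaseRate K S * (rate epsg epsc epsH)⁻¹ := by positivity
      push_cast
      linarith
    · have := h.redq_nonneg (hN.mono (Nat.succ_le_of_lt hj))
      linarith
  rw [div_mul_eq_mul_div, le_div_iff₀ (by positivity), ← div_le_iff₀ hR0]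
  have h4 := mul_le_mul_of_nonneg_left h3 hη.le
  rw [div_eq_mul_inv]
  linarith

/-- A linear function dominates the logarithm, from some threshold on. -/
lemma exists_forall_mul_log_le (W D : ℝ) (hW : 0 < W) :
    ∃ b, ∀ x, b ≤ x → W * (D + Real.log x) ≤ x := by
  have h1 := Real.isLittleO_log_id_atTop.bound (c := 1 / (2 * W)) (by positivity)
  obtain ⟨b, hb⟩ := Filter.eventually_atTop.1
    (h1.and (Filter.eventually_ge_atTop (max 0 (2 * W * D))))
  refine ⟨b, fun x hx => ?_⟩
  obtain ⟨h2, h3⟩ := hb x hx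
  have hx0 := (le_max_left _ _).trans h3
  have hxD := (le_max_right _ _).trans h3
  rw [id, Real.norm_of_nonneg hx0] at h2
  have h4 := mul_le_mul_of_nonneg_left ((le_abs_self _).trans h2) hW.le
  have h5 : W * (1 / (2 * W) * x) = x / 2 := by field_simp
  rw [h5] at h4
  linarith

end SCP

theorem mainTheorem1 (m : ℕ) (p : SCP.Params) (C : SCP.Constants m) :
    ∃ (alpha : Fin 4 → ℝ) (muMax sigmaStar : ℝ),
      (∀ i, 0 < alpha i) ∧ 0 < muMax ∧ 0 < sigmaStar ∧
      ∀ (n : ℕ) (Q : SCP.Problem n m) (X : Set (SCP.Vec n)) (T : SCP.Trace n m)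
        (flow epsg epsc epsH : ℝ),
        IsOpen X → Convex ℝ X → SCP.Regular Q X C →
        epsg ∈ Set.Ioo (0 : ℝ) 1 → epsc ∈ Set.Ioo (0 : ℝ) 1 → epsH ∈ Set.Ioo (0 : ℝ) 1 →
        T.IsRun p Q epsg epsc epsH →
        T.StaysIn p Q X epsg epsc epsH →
        (∀ k, T.Reached Q epsg epsc epsH k → flow ≤ Q.f (T.x k)) →
        let sigmaMax : ℝ := max p.sigma0 (p.gamma2 * sigmaStar)
        let ks : ℝ := SCP.kappaS p Q C (T.x 0) flow muMax alpha
        let kst : ℝ := SCP.kappaSt p ks sigmaMax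
        (∀ k, T.Reached Q epsg epsc epsH (k + 1) → T.mu k ≤ muMax) ∧
        (∀ k, T.Reached Q epsg epsc epsH k → T.sigma k ≤ sigmaMax) ∧
        ∃ k : ℕ, T.Reached Q epsg epsc epsH k ∧ T.Stationary Q epsg epsc epsH k ∧
          ({j : ℕ | j < k ∧ T.Successful p Q j}.ncard : ℤ)
            ≤ ⌈ks * SCP.rate epsg epsc epsH⌉ + 1 ∧
          (k : ℤ) ≤ ⌈kst * SCP.rate epsg epsc epsH⌉ + 1 ∧
          (k : ℤ) ≤ ⌈kst / Real.log p.gamma1 * SCP.rate epsg epsc epsH⌉ + 1 := by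
  have hK := C.one_le_bound
  have hs0 : 0 < p.sigma0 := p.sigmaMin_pos.trans_le p.sigmaMin_le
  have hg2 : 0 < p.gamma2 := (zero_lt_one.trans p.gamma1_gt).trans p.gamma2_gt
  have hL1 : 0 < Real.log p.gamma1 := Real.log_pos p.gamma1_gt
  have hL3 : Real.log p.gamma3 ≤ 0 := Real.log_nonpos p.gamma3_pos.le p.gamma3_le
  -- the factor `W` turns the bound with division by `log γ₁` into the one without
  set W : ℝ := max 1 (Real.log p.gamma1)⁻¹
  have hW1 : 1 ≤ W := le_max_left _ _
  have hWL : 1 ≤ W * Real.log p.gamma1 := by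
    calc 1 = (Real.log p.gamma1)⁻¹ * Real.log p.gamma1 := by field_simp
      _ ≤ _ := by gcongr; exact le_max_right _ _
  have hW0 : 0 < W := zero_lt_one.trans_le hW1
  -- the threshold is enlarged until `σ_max / σ₀` dominates all lower-order terms
  obtain ⟨b, hb⟩ := SCP.exists_forall_mul_log_le W (Real.log p.gamma1 - Real.log p.gamma3) hW0
  set sigmaStar : ℝ := max (max 1 (p.sigmaThreshold m C.bound)) (b * p.sigma0 / p.gamma2)
  have hstar0 : 0 < sigmaStar :=
    zero_lt_one.trans_le ((le_max_left _ _).trans (le_max_left _ _))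
  have hstarT : p.sigmaThreshold m C.bound ≤ sigmaStar :=
    (le_max_right _ _).trans (le_max_left _ _)
  have hstarb : b * p.sigma0 / p.gamma2 ≤ sigmaStar := le_max_right _ _
  set S : ℝ := max p.sigma0 (p.gamma2 * sigmaStar)
  have hS0 : 0 < S := hs0.trans_le (le_max_left _ _)
  have hα := p.decreaseRate_pos hK hS0
  refine ⟨fun _ => p.decreaseRate C.bound S / (2 * W), p.meritBound C.bound, sigmaStar,
    fun _ => by positivity, p.meritBound_pos _, hstar0, ?_⟩
  intro n Q X T flow epsg epsc epsH hX hXc hQ hg hc hH hrun hstay hflow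
  have h : SCP.RegularRun p Q T X C.bound epsg epsc epsH := ⟨hQ.smoothBounds hX hXc, hrun, hstay⟩
  dsimp only
  have hsig : ∀ k, T.Reached Q epsg epsc epsH k → T.sigma k ≤ S := fun k hk =>
    (h.sigma_le hg.1.le hc.1.le hH.1.le k hk).trans (max_le_max le_rfl (by gcongr))
  refine ⟨fun k hk => h.mu_le_meritBound hk, hsig, ?_⟩
  set R := SCP.rate epsg epsc epsH with hR
  have hR1 : 1 ≤ R := SCP.one_le_rate hc
  have hR0 : 0 < R := zero_lt_one.trans_le hR1
  set ks := SCP.kappaS p Q C (T.x 0) flow (p.meritBound C.bound)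
    (fun _ => p.decreaseRate C.bound S / (2 * W)) with hks
  have hκ : ∀ x ∈ X, SCP.l1 (Q.c x) ≤ ∑ i, C.kc i := fun x hx =>
    Finset.sum_le_sum fun i _ => (hQ.c_bdd i).1 x hx
  have hcount : ∀ N, T.Reached Q epsg epsc epsH N →
      W * ((SCP.successes p Q T N).card - 1 : ℝ) ≤ ks * R := by
    intro N hN
    have h1 := mul_le_mul_of_nonneg_left
      (h.card_sub_one_le hS0 hg hc hH hsig hκ hflow hN) hW0.le
    refine h1.trans_eq ?_
    have := p.eta1_pos
    rw [hks, SCP.kappaS, ciInf_const, ← hR]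
    field_simp
  have h0 : T.Reached Q epsg epsc epsH 0 := fun j hj => absurd hj (Nat.not_lt_zero j)
  have hks0 : 0 ≤ ks * R := by
    have h1 := hflow 0 h0
    have h2 : 0 ≤ ∑ i, C.kc i := (SCP.l1_nonneg _).trans (hκ _ (h.x_mem h0))
    have h3 := p.meritBound_pos C.bound
    have h4 := p.eta1_pos
    rw [hks, SCP.kappaS, ciInf_const]
    refine mul_nonneg (div_nonneg ?_ (by positivity)) hR0.le
    have := mul_nonneg h2 h3.le
    linarith
  have hD : 0 ≤ Real.log p.gamma1 - Real.log p.gamma3 := by linarith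
  have hx1 : 1 ≤ S / p.sigma0 := (one_le_div hs0).2 (le_max_left _ _)
  have hxb : W * (Real.log p.gamma1 - Real.log p.gamma3 + Real.log (S / p.sigma0))
      ≤ S / p.sigma0 := by
    refine hb _ ?_
    rw [le_div_iff₀ hs0]
    refine le_trans ?_ (le_max_right _ _)
    rwa [div_le_iff₀ hg2, mul_comm sigmaStar] at hstarb
  have hlogx := Real.log_nonneg hx1
  have htotal : ∀ N, T.Reached Q epsg epsc epsH N →
      W * (N * Real.log p.gamma1)
        ≤ (Real.log p.gamma1 - Real.log p.gamma3) * (ks * R) + S / p.sigma0 * R := by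
    intro N hN
    have h1 := h.mul_log_gamma1_le N hN
    have h2 : Real.log (T.sigma N / p.sigma0) ≤ Real.log (S / p.sigma0) := by
      have := h.sigma_pos hN
      exact Real.log_le_log (by positivity) (by gcongr; exact hsig N hN)
    have h3 := mul_le_mul_of_nonneg_left (h1.trans (add_le_add_right h2 _)) hW0.le
    have h4 := mul_le_mul_of_nonneg_left (hcount N hN) hD
    have h5 : S / p.sigma0 ≤ S / p.sigma0 * R := le_mul_of_one_le_right (by linarith) hR1
    linarith
  have hkst : SCP.kappaSt p ks S * R
      = (Real.log p.gamma1 - Real.log p.gamma3) * (ks * R) + S / p.sigma0 * R := by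
    rw [SCP.kappaSt]; ring
  have hN1 : ∀ N : ℕ, T.Reached Q epsg epsc epsH N → (N : ℝ) ≤ SCP.kappaSt p ks S * R := by
    intro N hN
    have h1 := htotal N hN
    rw [← hkst] at h1
    refine le_trans ?_ h1
    calc (N : ℝ) = N * 1 := (mul_one _).symm
      _ ≤ N * (W * Real.log p.gamma1) := by gcongr
      _ = _ := by ring
  have hN2 : ∀ N : ℕ, T.Reached Q epsg epsc epsH N →
      (N : ℝ) ≤ SCP.kappaSt p ks S / Real.log p.gamma1 * R := by
    intro N hN
    have h1 := htotal N hN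
    rw [← hkst] at h1
    rw [div_mul_eq_mul_div, le_div_iff₀ hL1]
    refine le_trans ?_ h1
    exact le_mul_of_one_le_left (by positivity) hW1
  have hex : ∃ k, T.Stationary Q epsg epsc epsH k := by
    by_contra hno
    obtain ⟨N, hN⟩ := exists_nat_gt (SCP.kappaSt p ks S * R)
    exact absurd (hN1 N fun j _ hj => hno ⟨j, hj⟩) (not_le.2 hN)
  classical
  refine ⟨Nat.find hex, fun j hj => Nat.find_min hex hj, Nat.find_spec hex, ?_, ?_, ?_⟩
  · rw [← SCP.coe_successes, Set.ncard_coe_finset, ← sub_le_iff_le_add]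
    have h1 := hcount (Nat.find hex) fun j hj => Nat.find_min hex hj
    have h2 : ((SCP.successes p Q T (Nat.find hex)).card : ℝ) - 1 ≤ ks * R := by
      rcases le_or_gt 0 (((SCP.successes p Q T (Nat.find hex)).card : ℝ) - 1) with h3 | h3
      · exact (le_mul_of_one_le_left h3 hW1).trans h1
      · exact h3.le.trans hks0
    have h3 := h2.trans (Int.le_ceil (ks * R))
    exact_mod_cast h3
  · have h1 := (hN1 (Nat.find hex) fun j hj => Nat.find_min hex hj).trans (Int.le_ceil _)
    have h2 : (Nat.find hex : ℤ) ≤ ⌈SCP.kappaSt p ks S * R⌉ := by exact_mod_cast h1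
    linarith
  · have h1 := (hN2 (Nat.find hex) fun j hj => Nat.find_min hex hj).trans (Int.le_ceil _)
    have h2 : (Nat.find hex : ℤ) ≤ ⌈SCP.kappaSt p ks S / Real.log p.gamma1 * R⌉ := by
      exact_mod_cast h1
    linarith
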